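/- A graph is finite, may have loops and parallel edges, and every edge consists of two half-edges, each incident on one vertex; a graph is 4-regular if every vertex is incident with exactly four half-edges. A circuit is a nonempty closed trail (vertices may repeat, no edge is used more than once), considered without starting point and without orientation. A circuit partition $P$ of $F$ is a set of circuits such that every edge of $F$ lies on exactly one of them; $\mathcal P(F)$ is the set of circuit partitions of $F$, $|P|$ is the number of circuits in $P$, and $c(F)$ is the number of connected components of $F$. An Euler system $C$ of $F$ is a set of circuits that contains exactly one Euler circuit of each connected component of $F$ and nothing else. It is labeled in a commutative ring $R$ by giving three functions $\phi_C,\chi_C,\psi_C:V(F)\to R$. Let $F$ be a 4-regular graph and $C$ an Euler system of $F$. At each vertex $v$, a circuit partition $P$ pairs up the four half-edges incident on $v$, two half-edges being paired when a circuit of $P$ enters $v$ along one and leaves along the other; this pairing is the transition of $P$ at $v$. Orient the circuits of $C$ arbitrarily and direct the edges of $F$ accordingly. Let $\phi(P,C)$ be the set of vertices where $P$ has the same transition as $C$, $\chi(P,C)$ the set of vertices where $P$ has the other transition consistent with the edge directions (each pair consists of an incoming and an outgoing half-edge), and $\psi(P,C)$ the set of vertices where the transition of $P$ is not consistent with the edge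 directions; these sets do not depend on the chosen orientations. For $y\in R$ let \[ \pi(F,C)=\sum_{P\in\mathcal P(F)}\Bigl(\prod_{v\in\phi(P,C)}\phi_C(v)\Bigr)\Bigl(\prod_{v\in\chi(P,C)}\chi_C(v)\Bigr)\Bigl(\prod_{v\in\psi(P,C)}\psi_C(v)\Bigr)\,y^{|P|-c(F)} . \] For a simple graph $G$ labeled by functions $\phi_G,\chi_G,\psi_G:V(G)\to R$, let $\mathcal P_\lambda(G)$ be the set of labeled partitions $P$ of $G$, i.e. partitions $V(G)=\phi(P)\cup\chi(P)\cup\psi(P)$ into three pairwise disjoint (possibly empty) labeled subsets. Let $G_P$ be the graph obtained from $G$ by removing every vertex of $\phi(P)$ and attaching a loop at every vertex of $\psi(P)$, and let $\nu(G_P)=|V(G_P)|-\operatorname{rank}$, where the rank is that of the adjacency matrix of $G_P$ over $GF(2)$ (diagonal entries being $1$ exactly at looped vertices). The labeled interlace polynomial of $G$ is \[ Q_\lambda(G)=\sum_{P\in\mathcal P_\lambda(G)}\Bigl(\prod_{v\in\phi(P)}\phi_G(v)\Bigr)\Bigl(\prod_{v\in\chi(P)}\chi_G(v)\Bigr)\Bigl(\prod_{v\in\psi(P)}\psi_G(v)\Bigr)\,y^{\nu(G_P)}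 . \] The labeled interlacement graph $\mathcal I(F,C)$ is the simple graph on $V(F)$ in which $v\ne w$ are adjacent if and only if they appear in the order $v\ldots w\ldots v\ldots w$ on one of the circuits of $C$, with the label functions $\phi_C,\chi_C,\psi_C$. Theorem. Let $F$ be a 4-regular graph with an $R$-labeled Euler system $C$, where $R$ is a commutative ring, let $y\in R$, and let $\mathcal I(F,C)$ be the corresponding labeled interlacement graph. Then \[ \pi(F,C)=Q_\lambda(\mathcal I(F,C)). \] -/

import Mathlib

/-- A graph on the vertex type `V`, with loops and parallel edges allowed, given by its half-edges:
`H` is the type of half-edges, `vert h` is the vertex on which `h` is incident, and `mate h` is the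
other half-edge of the edge containing `h`. The edges are the pairs `{h, mate h}`; an edge is a
loop when `vert h = vert (mate h)`. -/
structure HalfEdgeGraph (V H : Type*) where
  vert : H → V
  mate : H → H
  mate_mate : ∀ h, mate (mate h) = h
  mate_ne : ∀ h, mate h ≠ h

namespace HalfEdgeGraph

variable {V H : Type*} (F : HalfEdgeGraph V H)

/-- Every vertex is incident with exactly `k` half-edges (so a loop counts twice). -/
def IsRegular (k : ℕ) : Prop := ∀ v : V, {h : H | F.vert h = v}.ncard = k

/-- The simple graph obtained by discarding loops and identifying parallel edges. -/
def toSimpleGraph : SimpleGraph V where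
  Adj v w := v ≠ w ∧ ∃ h, F.vert h = v ∧ F.vert (F.mate h) = w
  symm := ⟨by
    rintro v w ⟨hne, h, hv, hw⟩
    exact ⟨hne.symm, F.mate h, hw, by rw [F.mate_mate]; exact hv⟩⟩
  loopless := ⟨fun _ h => h.1 rfl⟩

/-- A connected component of the graph (as a set of vertices). -/
abbrev Component := F.toSimpleGraph.ConnectedComponent

/-- `c(F)`, the number of connected components. -/
noncomputable def numComponents : ℕ := Nat.card F.Component

/-- The cyclic sequence `h₁, …, h_k` of half-edges describes the circuit that leaves the vertex
`vert hᵢ` along `hᵢ`, arrives along `mate hᵢ` at `vert hᵢ₊₁`, and finally closes up.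
No edge may be used twice, in the same or in opposite directions. -/
def IsOrientedCircuit (c : Cycle H) : Prop :=
  c ≠ Cycle.nil ∧ c.Chain (fun a b => F.vert (F.mate a) = F.vert b) ∧
    c.Nodup ∧ ∀ h ∈ c, F.mate h ∉ c

/-- Circuits with an orientation and without a starting point. -/
def OrientedCircuit := {c : Cycle H // F.IsOrientedCircuit c}

/-- The cyclic sequence obtained by traversing `c` backwards. -/
def rev (c : Cycle H) : Cycle H := (c.map F.mate).reverse

theorem rev_rev (c : Cycle H) : F.rev (F.rev c) = c := by
  induction c using Quotient.inductionOn with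
  | _ l =>
    change (((((l.map F.mate).reverse).map F.mate).reverse : List H) : Cycle H) = (l : Cycle H)
    have : F.mate ∘ F.mate = id := funext F.mate_mate
    simp [this]

/-- Two oriented circuits are the same circuit if they agree up to reversal. -/
instance circuitSetoid : Setoid F.OrientedCircuit where
  r c d := d.1 = c.1 ∨ d.1 = F.rev c.1
  iseqv :=
    { refl := fun _ => Or.inl rfl
      symm := by
        rintro c d (h | h)
        · exact Or.inl h.symm
        · exact Or.inr (by rw [h, F.rev_rev])
      trans := by
        rintro c d e (h | h) (k | k)
        · exact Or.inl (k.trans h)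
        · exact Or.inr (by rw [k, h])
        · exact Or.inr (by rw [k, h])
        · exact Or.inl (by rw [k, h, F.rev_rev]) }

/-- Circuits, considered without starting point and without orientation. -/
def Circuit := Quotient F.circuitSetoid

instance [Finite H] : Finite F.Circuit := by
  classical
  have := Fintype.ofFinite H
  have : Finite F.OrientedCircuit :=
    Finite.of_injective (β := {s : Cycle H // s.Nodup}) (fun c => ⟨c.1, c.2.2.2.1⟩)
      (fun c d h => Subtype.ext (Subtype.mk.inj h))
  exact inferInstanceAs (Finite (Quotient F.circuitSetoid))

variable {F}

/-- `c` is one of the two orientations of the circuit `γ`. -/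
def OrientedCircuit.IsOrientationOf (c : F.OrientedCircuit) (γ : F.Circuit) : Prop :=
  Quotient.mk F.circuitSetoid c = γ

/-- The edge `{h, mate h}` lies on the circuit `γ`. -/
def Circuit.Traverses (γ : F.Circuit) (h : H) : Prop :=
  ∃ c : F.OrientedCircuit, c.IsOrientationOf γ ∧ (h ∈ c.1 ∨ F.mate h ∈ c.1)

/-- On some passage through a vertex, the circuit `γ` enters along the half-edge `a` and leaves
along the half-edge `b`, for one of its two orientations. (A list is used that is read cyclically
so that the passage is the one from its last entry to its first.) -/
def Circuit.Pairs (γ : F.Circuit) (a b : H) : Prop :=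
  ∃ c : F.OrientedCircuit, c.IsOrientationOf γ ∧
    ∃ l : List H, c.1 = (l : Cycle H) ∧ l.getLast? = some (F.mate a) ∧ l.head? = some b

/-- With respect to one of the two orientations of `γ`, the half-edge `a` is terminal (traversed
towards its vertex) and the half-edge `b` is initial (traversed away from its vertex). -/
def Circuit.Directs (γ : F.Circuit) (a b : H) : Prop :=
  ∃ c : F.OrientedCircuit, c.IsOrientationOf γ ∧ F.mate a ∈ c.1 ∧ b ∈ c.1

/-- The vertices `v` and `w` appear in the order `v … w … v … w` on the circuit `γ`. -/
def Circuit.Interlaces (γ : F.Circuit) (v w : V) : Prop :=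
  ∃ c : F.OrientedCircuit, c.IsOrientationOf γ ∧
    ∃ l : List H, c.1 = (l : Cycle H) ∧ [v, w, v, w].Sublist (l.map F.vert)

theorem Circuit.Interlaces.symm {γ : F.Circuit} {v w : V} (h : γ.Interlaces v w) :
    γ.Interlaces w v := by
  obtain ⟨c, hc, l, hl, hs⟩ := h
  have hs' : ([v] ++ [w, v, w]).Sublist (l.map F.vert) := hs
  obtain ⟨r₁, r₂, hr, h₁, h₂⟩ := List.append_sublist_iff.1 hs'
  obtain ⟨l₁, l₂, rfl, rfl, rfl⟩ := List.map_eq_append_iff.1 hr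
  refine ⟨c, hc, l₂ ++ l₁, ?_, ?_⟩
  · rw [hl]
    exact Cycle.coe_eq_coe.2 List.isRotated_append
  · rw [List.map_append]
    exact (show ([w, v, w] ++ [v]).Sublist _ from h₂.append h₁)

/-- The circuit `γ` is an Euler circuit of the component `K`: it consists of all edges of `K`. -/
def Circuit.IsEulerCircuitOf (γ : F.Circuit) (K : F.Component) : Prop :=
  ∀ h, γ.Traverses h ↔ F.toSimpleGraph.connectedComponentMk (F.vert h) = K

variable (F)

/-- `P` is a partition of the edge set into edge-disjoint circuits. -/
def IsCircuitPartition (P : Finset F.Circuit) : Prop :=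
  ∀ h : H, ∃! γ, γ ∈ P ∧ γ.Traverses h

/-- `C` consists of one Euler circuit for each connected component. -/
def IsEulerSystem (C : Finset F.Circuit) : Prop :=
  (∀ γ ∈ C, ∃ K, γ.IsEulerCircuitOf K) ∧ ∀ K, ∃! γ, γ ∈ C ∧ γ.IsEulerCircuitOf K

/-- The circuit partitions of `F`. -/
def CircuitPartition := {P : Finset F.Circuit // F.IsCircuitPartition P}

noncomputable instance [Finite H] : Fintype F.CircuitPartition :=
  haveI : Finite F.CircuitPartition :=
    inferInstanceAs (Finite {P : Finset F.Circuit // F.IsCircuitPartition P})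
  Fintype.ofFinite _

end HalfEdgeGraph

/-- Three functions `φ`, `χ`, `ψ` from `V` to `R`. -/
structure LabelFunctions (V R : Type*) where
  phi : V → R
  chi : V → R
  psi : V → R

/-- An `R`-labeled Euler system of `F`. -/
structure LabeledEulerSystem {V H : Type*} (F : HalfEdgeGraph V H) (R : Type*)
    extends LabelFunctions V R where
  circuits : Finset F.Circuit
  isEulerSystem : F.IsEulerSystem circuits

/-- An `R`-labeled simple graph on the vertex type `V`. -/
structure LabeledSimpleGraph (V R : Type*) extends LabelFunctions V R where
  graph : SimpleGraph V

namespace HalfEdgeGraph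

variable {V H : Type*} {F : HalfEdgeGraph V H}

/-- Some circuit of `S` passes through a vertex along the half-edges `a` and `b`. At a vertex `v`
this relation is the transition of `S` at `v`. -/
def PairsIn (S : Finset F.Circuit) (a b : H) : Prop := ∃ γ ∈ S, γ.Pairs a b

/-- `P` and `C` have the same transition at `v` (transition `φ`). -/
def FollowsAt (P C : Finset F.Circuit) (v : V) : Prop :=
  ∀ a b, F.vert a = v → F.vert b = v → (PairsIn P a b ↔ PairsIn C a b)

/-- The transition of `P` at `v` is consistent with the directions that the circuits of `C` give
to the edges: it pairs terminal half-edges with initial half-edges. (`Directs` is unchanged if an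
orientation is reversed and `a`, `b` are exchanged, so the choice of orientations is immaterial.) -/
def ConsistentAt (P C : Finset F.Circuit) (v : V) : Prop :=
  ∀ a b, F.vert a = v → F.vert b = v → PairsIn P a b → ∃ γ ∈ C, γ.Directs a b

open Classical in
/-- The vertices where `P` involves the transition of `C`. -/
noncomputable def phiSet [Fintype V] (P C : Finset F.Circuit) : Finset V :=
  Finset.univ.filter fun v => FollowsAt P C v

open Classical in
/-- The vertices where `P` involves the transition different from that of `C` which is consistent
with the directions given by `C`. -/
noncomputable def chiSet [Fintype V] (P C : Finset F.Circuit) : Finset V :=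
  Finset.univ.filter fun v => ¬ FollowsAt P C v ∧ ConsistentAt P C v

open Classical in
/-- The vertices where `P` involves the transition inconsistent with the directions given by
`C`. -/
noncomputable def psiSet [Fintype V] (P C : Finset F.Circuit) : Finset V :=
  Finset.univ.filter fun v => ¬ ConsistentAt P C v

/-- The labeled circuit partition generating function `π(F, C)`. (In a 4-regular graph every
component contains an edge, so `|P| ≥ c(F)` and the subtraction is not truncated.) -/
noncomputable def circuitPartitionGF [Fintype V] [Finite H] {R : Type*} [CommRing R]
    (F : HalfEdgeGraph V H) (C : LabeledEulerSystem F R) (y : R) : R :=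
  ∑ P : F.CircuitPartition,
    (∏ v ∈ phiSet P.1 C.circuits, C.phi v) * (∏ v ∈ chiSet P.1 C.circuits, C.chi v) *
      (∏ v ∈ psiSet P.1 C.circuits, C.psi v) * y ^ (P.1.card - F.numComponents)

/-- The interlacement graph: distinct vertices are adjacent when they are interlaced on one of the
circuits of `C`. -/
def interlacementGraph (C : Finset F.Circuit) : SimpleGraph V where
  Adj v w := v ≠ w ∧ ∃ γ ∈ C, γ.Interlaces v w
  symm := ⟨by
    rintro v w ⟨hne, γ, hγ, h⟩
    exact ⟨hne.symm, γ, hγ, h.symm⟩⟩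
  loopless := ⟨fun _ h => h.1 rfl⟩

/-- The labeled interlacement graph `I(F, C)`: its labels are those of `C`. -/
def labeledInterlacementGraph {R : Type*} (F : HalfEdgeGraph V H) (C : LabeledEulerSystem F R) :
    LabeledSimpleGraph V R where
  toLabelFunctions := C.toLabelFunctions
  graph := interlacementGraph C.circuits

end HalfEdgeGraph

/-- A graph without parallel edges in which loops are allowed. -/
structure LoopedGraph (W : Type*) where
  Adj : W → W → Prop
  symm : ∀ v w, Adj v w → Adj w v

namespace LoopedGraph

open Classical in
/-- The adjacency matrix over `GF(2)`. -/
noncomputable def adjMatrix {W : Type*} (G : LoopedGraph W) : Matrix W W (ZMod 2) :=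
  Matrix.of fun v w => if G.Adj v w then 1 else 0

/-- The `GF(2)`-nullity of the adjacency matrix. -/
noncomputable def nullity {W : Type*} [Fintype W] (G : LoopedGraph W) : ℕ :=
  Fintype.card W - G.adjMatrix.rank

end LoopedGraph

/-- The names of the three classes of a labeled partition. -/
inductive PartLabel
  | phi
  | chi
  | psi

instance : DecidableEq PartLabel := fun a b => by
  cases a <;> cases b <;> first | exact isTrue rfl | exact isFalse nofun

instance : Fintype PartLabel where
  elems := {PartLabel.phi, PartLabel.chi, PartLabel.psi}
  complete := by rintro (_ | _ | _) <;> simp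

/-- A labeled partition of `V` into `φ(P)`, `χ(P)`, `ψ(P)` (any of which may be empty), given by
the function that tells the class of each vertex. -/
abbrev LabeledPartition (V : Type*) := V → PartLabel

namespace LabeledSimpleGraph

variable {V R : Type*}

/-- `G_P`: remove the vertices of `φ(P)` and attach a loop at every vertex of `ψ(P)`. -/
def assocGraph (G : SimpleGraph V) (P : LabeledPartition V) :
    LoopedGraph {v : V // P v ≠ PartLabel.phi} where
  Adj v w := G.Adj v.1 w.1 ∨ (v = w ∧ P v.1 = PartLabel.psi)
  symm := by
    rintro v w (h | ⟨rfl, h⟩)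
    · exact Or.inl h.symm
    · exact Or.inr ⟨rfl, h⟩

open Classical in
/-- The labeled interlace polynomial `Q_λ(G)`. -/
noncomputable def interlacePolynomial [Fintype V] [CommRing R] (G : LabeledSimpleGraph V R)
    (y : R) : R :=
  ∑ P : LabeledPartition V,
    (∏ v with P v = PartLabel.phi, G.phi v) * (∏ v with P v = PartLabel.chi, G.chi v) *
      (∏ v with P v = PartLabel.psi, G.psi v) * y ^ (assocGraph G.graph P).nullity

end LabeledSimpleGraph

/-! A circuit partition amounts to a choice of transition at every vertex, that is, to a
fixed-point-free involution `τ` of the half-edges preserving `vert`. Let `ρ` be the transition of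
the Euler system, and let `κ` pair the two outgoing and the two incoming half-edges at each vertex.
At a vertex the only transitions are `ρ`, `ρ ∘ κ` and `κ`, named φ, χ and ψ, so circuit partitions
correspond bijectively to labeled partitions (`partitionOf_bijective`). The label products then
agree term by term, and what remains is the circuit-nullity formula
`card_eq_numComponents_add_nullity`.

That formula is proved by linear algebra over GF(2). The edge functions that are constant along the
transitions `τ` form a space of dimension |P| (`HasTransition.finrank_invariants`). The derivative
of such an `f` is the vertex function g(v) = f(h) + f(ρ h), with h any half-edge at v. It vanishes
exactly on the invariants of `ρ`, a space of dimension c(F).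

Conversely, every g has an integral f along the Euler circuits, a sum of indicators of arcs from a
vertex back to itself (`exists_integral`). If A is the adjacency matrix of the interlacement graph,
then f(h) + f(κ h) = g(v) + (A g)(v), because the arc at w separates the two passages through v ≠ w
exactly when v and w are interlaced. Invariance of f under `τ` thus reads g(v) = 0, (A g)(v) = 0 or
(A g)(v) + g(v) = 0 according as v is in φ, χ or ψ. This says that g is in the kernel of the
adjacency matrix of G_P, and rank-nullity concludes. -/

/-! ### Cyclic sequences and their chains. -/

/-- A nontrivial rotation would bring an entry of `s` to the front, and no such entry equals `a`. -/
theorem List.IsRotated.eq_of_cons {α : Type*} {a : α} {s t : List α}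
    (h : List.IsRotated (a :: s) (a :: t)) (hs : (a :: s).Nodup) : s = t := by
  obtain ⟨n, hn, e⟩ := List.isRotated_iff_mod.1 h
  rw [List.rotate_eq_drop_append_take hn] at e
  cases n with
  | zero => simpa using e
  | succ k =>
    rw [List.drop_succ_cons, List.take_succ_cons] at e
    cases hd : s.drop k with
    | nil =>
      rw [hd] at e
      rw [← List.take_of_length_le (List.drop_eq_nil_iff.1 hd)]
      simpa using e
    | cons b r =>
      rw [hd, List.cons_append, List.cons.injEq] at e
      have hb : b ∈ s := List.mem_of_mem_drop (hd ▸ List.mem_cons_self)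
      exact absurd (e.1 ▸ hb) (List.nodup_cons.1 hs).1

namespace Cycle

variable {α : Type*}

theorem Chain.rel_getLast?_head? {r : α → α → Prop} {c : Cycle α} (hc : c.Chain r) {l : List α}
    {a b : α} (hl : c = (l : Cycle α)) (ha : l.getLast? = some a) (hb : l.head? = some b) :
    r a b := by
  subst hl
  cases l with
  | nil => simp at hb
  | cons x t =>
    rw [chain_ne_nil r (List.cons_ne_nil x t)] at hc
    rw [List.getLast?_eq_some_getLast (List.cons_ne_nil x t), Option.some.injEq] at ha
    rw [List.head?_cons, Option.some.injEq] at hb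
    rw [ha, hb] at hc
    exact (List.isChain_cons_cons.1 hc).1

/-- Each pair of cyclically consecutive entries is the (last, first) pair of a suitable rotation.
This links `Chain` to the form of passages used in `Circuit.Pairs`. -/
theorem chain_of_forall_getLast?_head? {r : α → α → Prop} {c : Cycle α}
    (h : ∀ (l : List α) (a b : α), c = (l : Cycle α) → l.getLast? = some a → l.head? = some b →
      r a b) : c.Chain r := by
  have key : ∀ (l₂ l₁ : List α) (a : α), c = ((l₁ ++ a :: l₂ : List α) : Cycle α) →
      List.IsChain r (a :: l₂) := by
    intro l₂
    induction l₂ with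
    | nil => intro l₁ a _; exact List.isChain_singleton a
    | cons b l₃ ih =>
      intro l₁ a hc
      refine List.isChain_cons_cons.2 ⟨h (b :: l₃ ++ (l₁ ++ [a])) a b ?_ ?_ ?_,
        ih (l₁ ++ [a]) b (by rw [hc]; simp)⟩
      · rw [hc, coe_eq_coe]
        have : l₁ ++ a :: b :: l₃ = (l₁ ++ [a]) ++ (b :: l₃) := by simp
        rw [this]
        exact List.isRotated_append
      · rw [← List.append_assoc, List.getLast?_append]; simp
      · simp
  induction c using Cycle.induction_on with
  | nil => trivial
  | cons x t _ =>
    rw [chain_ne_nil r (List.cons_ne_nil x t)]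
    exact List.isChain_cons_cons.2
      ⟨h (x :: t) _ _ rfl (List.getLast?_eq_some_getLast _) rfl, key t [] x rfl⟩

theorem exists_coe_cons_of_mem {c : Cycle α} {a : α} (h : a ∈ c) :
    ∃ l : List α, c = ((a :: l : List α) : Cycle α) := by
  induction c using Quotient.inductionOn with
  | _ l =>
    obtain ⟨s, t, rfl⟩ := List.append_of_mem (show a ∈ l from h)
    exact ⟨t ++ s, coe_eq_coe.2 List.isRotated_append⟩

theorem chain_reverse {r : α → α → Prop} {c : Cycle α} :
    c.reverse.Chain r ↔ c.Chain fun a b => r b a := by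
  suffices h : ∀ (r : α → α → Prop) (c : Cycle α), c.Chain (fun a b => r b a) →
      c.reverse.Chain r from
    ⟨fun hc => by simpa using h (fun a b => r b a) c.reverse hc, h r c⟩
  intro r c hc
  refine chain_of_forall_getLast?_head? fun l a b hl ha hb => ?_
  have : c = (l.reverse : Cycle α) := by rw [← reverse_reverse c, hl, reverse_coe]
  exact hc.rel_getLast?_head? this (by simpa using hb) (by simpa using ha)

/-- Started at the common entry `a`, both cycles list the iterates of `f` until `a` recurs, hence
they agree and stop together. -/
theorem eq_of_chain_of_mem {f : α → α} {c d : Cycle α} (hc : c.Nodup) (hd : d.Nodup)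
    (hcf : c.Chain fun a b => b = f a) (hdf : d.Chain fun a b => b = f a) {a : α} (hac : a ∈ c)
    (had : a ∈ d) : c = d := by
  have key : ∀ (s t : List α) (x : α), a ∉ s → a ∉ t →
      List.IsChain (fun a b => b = f a) (x :: (s ++ [a])) →
      List.IsChain (fun a b => b = f a) (x :: (t ++ [a])) → s = t := by
    intro s
    induction s with
    | nil =>
      intro t x _ ht h₁ h₂
      cases t with
      | nil => rfl
      | cons y t =>
        simp only [List.nil_append, List.cons_append, List.isChain_cons_cons] at h₁ h₂
        exact absurd (h₁.1.trans h₂.1.symm) (fun e => ht (by simp [e]))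
    | cons z s ih =>
      intro t x hs ht h₁ h₂
      cases t with
      | nil =>
        simp only [List.nil_append, List.cons_append, List.isChain_cons_cons] at h₁ h₂
        exact absurd (h₂.1.trans h₁.1.symm) (fun e => hs (by simp [e]))
      | cons y t =>
        simp only [List.cons_append, List.isChain_cons_cons] at h₁ h₂
        obtain rfl : z = y := h₁.1.trans h₂.1.symm
        rw [ih t z (fun h => hs (List.mem_cons_of_mem _ h))
          (fun h => ht (List.mem_cons_of_mem _ h)) h₁.2 h₂.2]
  obtain ⟨s, rfl⟩ := exists_coe_cons_of_mem hac
  obtain ⟨t, rfl⟩ := exists_coe_cons_of_mem had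
  rw [chain_coe_cons] at hcf hdf
  rw [nodup_coe_iff] at hc hd
  rw [key s t a (List.nodup_cons.1 hc).1 (List.nodup_cons.1 hd).1 hcf hdf]

theorem Chain.rel_of_mem {r : α → α → Prop} {c : Cycle α} (hc : c.Chain r) {a : α} (ha : a ∈ c) :
    ∃ b ∈ c, r a b := by
  obtain ⟨l, rfl⟩ := exists_coe_cons_of_mem ha
  cases l with
  | nil => exact ⟨a, ha, (chain_singleton r a).1 hc⟩
  | cons b l =>
    rw [chain_coe_cons, List.cons_append, List.isChain_cons_cons] at hc
    exact ⟨b, by simp, hc.1⟩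

end Cycle

/-! ### Orientations of circuits and their passages through vertices. -/

namespace HalfEdgeGraph

variable {V H : Type*} {F : HalfEdgeGraph V H}

theorem mem_rev {c : Cycle H} {h : H} : h ∈ F.rev c ↔ F.mate h ∈ c := by
  rw [rev, Cycle.mem_reverse_iff, Cycle.mem_map]
  exact ⟨fun ⟨a, ha, e⟩ => by rw [← e, F.mate_mate]; exact ha, fun ha => ⟨_, ha, F.mate_mate h⟩⟩

theorem mate_injective : Function.Injective F.mate :=
  Function.LeftInverse.injective F.mate_mate

theorem chain_rev {r : H → H → Prop} {c : Cycle H} :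
    (F.rev c).Chain r ↔ c.Chain fun a b => r (F.mate b) (F.mate a) := by
  rw [rev, Cycle.chain_reverse, Cycle.chain_map]

theorem IsOrientedCircuit.rev {c : Cycle H} (hc : F.IsOrientedCircuit c) :
    F.IsOrientedCircuit (F.rev c) := by
  obtain ⟨h₁, h₂, h₃, h₄⟩ := hc
  refine ⟨fun h => h₁ ?_, ?_, ?_, fun h hh => ?_⟩
  · rw [← F.rev_rev c, h]; rfl
  · rw [chain_rev]
    refine h₂.imp fun a b h => ?_
    rw [F.mate_mate, h]
  · rw [HalfEdgeGraph.rev, Cycle.nodup_reverse_iff]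
    induction c using Quotient.inductionOn with
    | _ l => exact List.Nodup.map mate_injective h₃
  · rw [mem_rev, F.mate_mate]
    exact fun hm => h₄ h hm (mem_rev.1 hh)

/-- An oriented circuit traversed backwards. -/
def OrientedCircuit.rev (c : F.OrientedCircuit) : F.OrientedCircuit :=
  ⟨F.rev c.1, IsOrientedCircuit.rev c.2⟩

theorem OrientedCircuit.IsOrientationOf.rev {c : F.OrientedCircuit} {γ : F.Circuit}
    (h : c.IsOrientationOf γ) : c.rev.IsOrientationOf γ := by
  rw [← h]
  exact Quotient.sound (Setoid.symm (Or.inr rfl : F.circuitSetoid.r c c.rev))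

theorem OrientedCircuit.IsOrientationOf.eq_or_eq_rev {c d : F.OrientedCircuit} {γ : F.Circuit}
    (hc : c.IsOrientationOf γ) (hd : d.IsOrientationOf γ) : d.1 = c.1 ∨ d.1 = F.rev c.1 :=
  Quotient.exact (hc.trans hd.symm)

/-- The two orientations share no half-edge, since no edge is used in both directions. -/
theorem OrientedCircuit.IsOrientationOf.eq_of_mem {c d : F.OrientedCircuit} {γ : F.Circuit}
    (hc : c.IsOrientationOf γ) (hd : d.IsOrientationOf γ) {h : H} (hhc : h ∈ c.1)
    (hhd : h ∈ d.1) : c = d := by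
  rcases hc.eq_or_eq_rev hd with e | e
  · exact Subtype.ext e.symm
  · rw [e, mem_rev] at hhd
    exact absurd hhd (c.2.2.2.2 h hhc)

theorem Circuit.exists_orientation (γ : F.Circuit) :
    ∃ c : F.OrientedCircuit, c.IsOrientationOf γ :=
  Quotient.exists_rep γ

theorem Circuit.Traverses.exists_mem {γ : F.Circuit} {h : H} (hγ : γ.Traverses h) :
    ∃ c : F.OrientedCircuit, c.IsOrientationOf γ ∧ h ∈ c.1 := by
  obtain ⟨c, hc, hh | hh⟩ := hγ
  · exact ⟨c, hc, hh⟩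
  · exact ⟨c.rev, hc.rev, mem_rev.2 hh⟩

theorem Circuit.traverses_mate {γ : F.Circuit} {h : H} :
    γ.Traverses (F.mate h) ↔ γ.Traverses h := by
  simp only [Traverses, F.mate_mate, or_comm]

theorem Circuit.traverses_iff_of_isOrientationOf {γ : F.Circuit} {c : F.OrientedCircuit}
    (hc : c.IsOrientationOf γ) {h : H} : γ.Traverses h ↔ h ∈ c.1 ∨ F.mate h ∈ c.1 := by
  refine ⟨fun ⟨d, hd, hh⟩ => ?_, fun hh => ⟨c, hc, hh⟩⟩
  rcases hc.eq_or_eq_rev hd with e | e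
  · rwa [← e]
  · rw [e, mem_rev, mem_rev, F.mate_mate] at hh
    exact hh.symm

theorem Circuit.exists_traverses (γ : F.Circuit) : ∃ h, γ.Traverses h := by
  obtain ⟨⟨c, hc'⟩, hc⟩ := γ.exists_orientation
  induction c using Cycle.induction_on with
  | nil => exact absurd rfl hc'.1
  | cons a l _ => exact ⟨a, _, hc, Or.inl (by simp)⟩

theorem Circuit.Pairs.symm {γ : F.Circuit} {a b : H} (h : γ.Pairs a b) : γ.Pairs b a := by
  obtain ⟨c, hc, l, hl, ha, hb⟩ := h
  refine ⟨c.rev, hc.rev, (l.map F.mate).reverse, ?_, ?_, ?_⟩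
  · change F.rev c.1 = _
    rw [hl]; rfl
  · simp [hb]
  · simp [ha, F.mate_mate]

theorem Circuit.Pairs.exists_orientation {γ : F.Circuit} {a b : H} (h : γ.Pairs a b) :
    ∃ c : F.OrientedCircuit, c.IsOrientationOf γ ∧ F.mate a ∈ c.1 ∧ b ∈ c.1 := by
  obtain ⟨c, hc, l, hl, ha, hb⟩ := h
  refine ⟨c, hc, ?_, ?_⟩ <;> rw [hl, Cycle.mem_coe_iff]
  · exact List.mem_of_getLast? ha
  · exact List.mem_of_mem_head? hb

theorem Circuit.Pairs.traverses_left {γ : F.Circuit} {a b : H} (h : γ.Pairs a b) :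
    γ.Traverses a := by
  obtain ⟨c, hc, ha, -⟩ := h.exists_orientation
  exact ⟨c, hc, Or.inr ha⟩

theorem Circuit.Pairs.vert_eq {γ : F.Circuit} {a b : H} (h : γ.Pairs a b) :
    F.vert b = F.vert a := by
  obtain ⟨c, hc, l, hl, ha, hb⟩ := h
  have := c.2.2.1.rel_getLast?_head? hl ha hb
  rw [F.mate_mate] at this
  exact this.symm

theorem Circuit.Pairs.ne {γ : F.Circuit} {a b : H} (h : γ.Pairs a b) : b ≠ a := by
  obtain ⟨c, hc, ha, hb⟩ := h.exists_orientation
  rintro rfl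
  exact c.2.2.2.2 _ hb ha

theorem Circuit.Traverses.exists_pairs {γ : F.Circuit} {a : H} (h : γ.Traverses a) :
    ∃ b, γ.Pairs a b := by
  obtain ⟨c, hc, ha⟩ := (traverses_mate.2 h).exists_mem
  obtain ⟨l, hl⟩ := Cycle.exists_coe_cons_of_mem ha
  refine ⟨(l ++ [F.mate a]).head (by simp), c, hc, l ++ [F.mate a], ?_, by simp,
    List.head?_eq_some_head _⟩
  rw [hl]
  exact Cycle.coe_cons_eq_coe_append _ _

/-! ### Circuit partitions and transition involutions. -/

/-- A transition at every vertex, given by the involution that exchanges the half-edges of every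
pair. -/
structure IsTransition (F : HalfEdgeGraph V H) (τ : H → H) : Prop where
  invol : ∀ h, τ (τ h) = h
  ne : ∀ h, τ h ≠ h
  vert : ∀ h, F.vert (τ h) = F.vert h

/-- At every passage through a vertex the cyclic sequence `c` goes from `a` to `τ a`. -/
def Uses (F : HalfEdgeGraph V H) (τ : H → H) (c : Cycle H) : Prop :=
  c.Chain fun a b => b = τ (F.mate a)

theorem IsTransition.uses_rev {τ : H → H} (hτ : F.IsTransition τ) {c : Cycle H}
    (hc : F.Uses τ c) : F.Uses τ (F.rev c) := by
  rw [Uses, chain_rev]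
  refine hc.imp fun a b h => ?_
  rw [h, F.mate_mate, hτ.invol]

theorem IsTransition.uses_orientation {τ : H → H} (hτ : F.IsTransition τ)
    {c d : F.OrientedCircuit} {γ : F.Circuit} (hc : c.IsOrientationOf γ)
    (hd : d.IsOrientationOf γ) (h : F.Uses τ c.1) : F.Uses τ d.1 := by
  rcases hc.eq_or_eq_rev hd with e | e <;> rw [e]
  · exact h
  · exact hτ.uses_rev h

/-- The circuits that involve the transitions `τ`. -/
noncomputable def circuitsOf (F : HalfEdgeGraph V H) [Finite H] (τ : H → H) : Finset F.Circuit :=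
  (Set.toFinite {γ : F.Circuit | ∃ c : F.OrientedCircuit, c.IsOrientationOf γ ∧
    F.Uses τ c.1}).toFinset

theorem mem_circuitsOf [Finite H] {τ : H → H} {γ : F.Circuit} :
    γ ∈ F.circuitsOf τ ↔ ∃ c : F.OrientedCircuit, c.IsOrientationOf γ ∧ F.Uses τ c.1 := by
  simp [circuitsOf]

theorem IsTransition.uses_of_mem_circuitsOf [Finite H] {τ : H → H} (hτ : F.IsTransition τ)
    {γ : F.Circuit} (hγ : γ ∈ F.circuitsOf τ) {c : F.OrientedCircuit}
    (hc : c.IsOrientationOf γ) : F.Uses τ c.1 := by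
  obtain ⟨d, hd, h⟩ := mem_circuitsOf.1 hγ
  exact hτ.uses_orientation hd hc h

theorem OrientedCircuit.eq_of_uses {τ : H → H} {c d : F.OrientedCircuit} (hc : F.Uses τ c.1)
    (hd : F.Uses τ d.1) {h : H} (hhc : h ∈ c.1) (hhd : h ∈ d.1) : c = d :=
  Subtype.ext (Cycle.eq_of_chain_of_mem (f := fun a => τ (F.mate a)) c.2.2.2.1 d.2.2.2.1
    hc hd hhc hhd)

/-- A walk that returns along its first edge can be shortened by one step at each end, until it
violates `mate h ≠ h` or `τ h ≠ h`. Hence an orbit of `τ ∘ mate` never uses an edge in both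
directions. -/
theorem IsTransition.iterate_ne_mate {τ : H → H} (hτ : F.IsTransition τ) (n : ℕ) (h : H) :
    (fun a => τ (F.mate a))^[n] h ≠ F.mate h := by
  induction n using Nat.twoStepInduction generalizing h with
  | zero => exact (F.mate_ne h).symm
  | one => exact hτ.ne _
  | more n ih _ =>
    intro e
    rw [Function.iterate_succ_apply, Function.iterate_succ_apply'] at e
    refine ih (τ (F.mate h)) ?_
    have := congrArg (fun a => F.mate (τ a)) e
    simpa only [hτ.invol, F.mate_mate] using this

/-- The circuit is the orbit of `h` under the permutation `τ ∘ mate` of a finite set. -/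
theorem IsTransition.exists_uses [Finite H] {τ : H → H} (hτ : F.IsTransition τ) (h : H) :
    ∃ c : F.OrientedCircuit, F.Uses τ c.1 ∧ h ∈ c.1 := by
  set f : H → H := fun a => τ (F.mate a) with hf
  have hinj : Function.Injective f :=
    (Function.LeftInverse.injective hτ.invol).comp mate_injective
  have hper := fun h => hinj.mem_periodicPts h
  have huse : F.Uses τ (Function.periodicOrbit f h) := by
    rw [Uses, Function.periodicOrbit_chain' _ (hper h)]
    intro n
    rw [Function.iterate_succ_apply']
  refine ⟨⟨Function.periodicOrbit f h, fun e => ?_, huse.imp ?_, Function.nodup_periodicOrbit,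
    fun a ha hm => ?_⟩, huse, Function.self_mem_periodicOrbit (hper h)⟩
  · have := Function.self_mem_periodicOrbit (hper h)
    rw [e] at this
    exact Cycle.notMem_nil _ this
  · rintro a b rfl
    exact (hτ.vert _).symm
  · obtain ⟨m, rfl⟩ := (Function.mem_periodicOrbit_iff (hper h)).1 ha
    rw [Function.periodicOrbit_apply_iterate_eq (hper h) m |>.symm,
      Function.mem_periodicOrbit_iff (hper _)] at hm
    obtain ⟨n, hn⟩ := hm
    exact hτ.iterate_ne_mate n _ hn

theorem IsTransition.isCircuitPartition [Finite H] {τ : H → H} (hτ : F.IsTransition τ) :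
    F.IsCircuitPartition (F.circuitsOf τ) := by
  intro h
  obtain ⟨c, hc, hh⟩ := hτ.exists_uses h
  refine ⟨Quotient.mk F.circuitSetoid c, ⟨mem_circuitsOf.2 ⟨c, rfl, hc⟩, c, rfl, Or.inl hh⟩, ?_⟩
  rintro γ ⟨hγ, ht⟩
  obtain ⟨d, hd, hhd⟩ := ht.exists_mem
  rw [← hd, OrientedCircuit.eq_of_uses hc (hτ.uses_of_mem_circuitsOf hγ hd) hh hhd]

/-- The relation `PairsIn P` is the graph of the involution `τ`. -/
def HasTransition (P : Finset F.Circuit) (τ : H → H) : Prop := ∀ a b, PairsIn P a b ↔ b = τ a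

theorem IsTransition.hasTransition_circuitsOf [Finite H] {τ : H → H} (hτ : F.IsTransition τ) :
    HasTransition (F.circuitsOf τ) τ := by
  have key : ∀ a b, PairsIn (F.circuitsOf τ) a b → b = τ a := by
    rintro a b ⟨γ, hγ, c, hc, l, hl, ha, hb⟩
    have := (hτ.uses_of_mem_circuitsOf hγ hc).rel_getLast?_head? hl ha hb
    rwa [F.mate_mate] at this
  refine fun a b => ⟨key a b, ?_⟩
  rintro rfl
  obtain ⟨γ, ⟨hγ, ht⟩, -⟩ := hτ.isCircuitPartition a
  obtain ⟨b, hb⟩ := ht.exists_pairs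
  have := key a b ⟨γ, hγ, hb⟩
  exact ⟨γ, hγ, this ▸ hb⟩

/-- Only one orientation contains `mate a`, and only one rotation of it ends with `mate a`. -/
theorem Circuit.Pairs.right_unique {γ : F.Circuit} {a b b' : H} (h : γ.Pairs a b)
    (h' : γ.Pairs a b') : b = b' := by
  obtain ⟨c, hc, l, hl, ha, hb⟩ := h
  obtain ⟨c', hc', l', hl', ha', hb'⟩ := h'
  have hm : F.mate a ∈ c.1 := by rw [hl]; exact List.mem_of_getLast? ha
  have hm' : F.mate a ∈ c'.1 := by rw [hl']; exact List.mem_of_getLast? ha'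
  obtain rfl := hc.eq_of_mem hc' hm hm'
  obtain ⟨s, rfl⟩ := List.getLast?_eq_some_iff.1 ha
  obtain ⟨s', rfl⟩ := List.getLast?_eq_some_iff.1 ha'
  have hnd : (F.mate a :: s).Nodup := by
    have := c.2.2.2.1
    rwa [hl, ← Cycle.coe_cons_eq_coe_append, Cycle.nodup_coe_iff] at this
  have e : ((F.mate a :: s : List H) : Cycle H) = ((F.mate a :: s' : List H) : Cycle H) := by
    rw [Cycle.coe_cons_eq_coe_append, Cycle.coe_cons_eq_coe_append, ← hl, hl']
  obtain rfl := (Cycle.coe_eq_coe.1 e).eq_of_cons hnd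
  exact Option.some.inj (hb.symm.trans hb')

theorem IsCircuitPartition.exists_hasTransition {P : Finset F.Circuit}
    (hP : F.IsCircuitPartition P) : ∃ τ, F.IsTransition τ ∧ HasTransition P τ := by
  have hex : ∀ a, ∃ b, PairsIn P a b := fun a => by
    obtain ⟨γ, ⟨hγ, ht⟩, -⟩ := hP a
    obtain ⟨b, hb⟩ := ht.exists_pairs
    exact ⟨b, γ, hγ, hb⟩
  choose τ hτ using hex
  have huniq : ∀ a b, PairsIn P a b → b = τ a := by
    rintro a b ⟨γ, hγ, hb⟩
    obtain ⟨γ', hγ', hb'⟩ := hτ a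
    obtain rfl := (hP a).unique ⟨hγ, hb.traverses_left⟩ ⟨hγ', hb'.traverses_left⟩
    exact hb.right_unique hb'
  have hsymm : ∀ a b, PairsIn P a b → PairsIn P b a := fun a b ⟨γ, hγ, h⟩ => ⟨γ, hγ, h.symm⟩
  refine ⟨τ, ⟨fun h => (huniq _ _ (hsymm _ _ (hτ h))).symm, fun h => ?_, fun h => ?_⟩,
    fun a b => ⟨huniq a b, fun e => e ▸ hτ a⟩⟩
  · obtain ⟨γ, -, hp⟩ := hτ h
    exact hp.ne
  · obtain ⟨γ, -, hp⟩ := hτ h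
    exact hp.vert_eq

theorem HasTransition.uses {P : Finset F.Circuit} {τ : H → H} (h : HasTransition P τ)
    {γ : F.Circuit} (hγ : γ ∈ P) {c : F.OrientedCircuit} (hc : c.IsOrientationOf γ) :
    F.Uses τ c.1 := by
  refine Cycle.chain_of_forall_getLast?_head? fun l a b hl ha hb => ?_
  exact (h _ _).1 ⟨γ, hγ, c, hc, l, hl, by rw [F.mate_mate]; exact ha, hb⟩

/-- Two circuits that follow `τ` and share an edge coincide, so a circuit following `τ` equals the
member of `P` through any of its edges. -/
theorem HasTransition.eq_circuitsOf [Finite H] {P : Finset F.Circuit} {τ : H → H}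
    (h : HasTransition P τ) (hP : F.IsCircuitPartition P) (hτ : F.IsTransition τ) :
    P = F.circuitsOf τ := by
  ext γ
  refine ⟨fun hγ => ?_, fun hγ => ?_⟩
  · obtain ⟨c, hc⟩ := γ.exists_orientation
    exact mem_circuitsOf.2 ⟨c, hc, h.uses hγ hc⟩
  · obtain ⟨a, ha⟩ := γ.exists_traverses
    obtain ⟨γ', ⟨hγ', ht'⟩, -⟩ := hP a
    obtain ⟨c, hc, hac⟩ := ha.exists_mem
    obtain ⟨c', hc', hac'⟩ := ht'.exists_mem
    rw [← hc, OrientedCircuit.eq_of_uses (hτ.uses_of_mem_circuitsOf hγ hc)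
      (h.uses hγ' hc') hac hac', hc']
    exact hγ'

/-! ### Euler systems and the directions they induce. -/

theorem IsEulerSystem.traverses_of_vert_eq {C : Finset F.Circuit} (hC : F.IsEulerSystem C)
    {γ : F.Circuit} (hγ : γ ∈ C) {a b : H} (hab : F.vert b = F.vert a) (ha : γ.Traverses a) :
    γ.Traverses b := by
  obtain ⟨K, hK⟩ := hC.1 γ hγ
  rw [hK] at ha ⊢
  rw [hab, ha]

theorem IsEulerSystem.isCircuitPartition {C : Finset F.Circuit} (hC : F.IsEulerSystem C) :
    F.IsCircuitPartition C := by
  intro h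
  obtain ⟨γ, ⟨hγ, hK⟩, huniq⟩ := hC.2 (F.toSimpleGraph.connectedComponentMk (F.vert h))
  refine ⟨γ, ⟨hγ, (hK h).2 rfl⟩, fun γ' ⟨hγ', ht⟩ => huniq γ' ⟨hγ', ?_⟩⟩
  obtain ⟨K', hK'⟩ := hC.1 γ' hγ'
  rwa [(hK' h).1 ht]

theorem IsEulerSystem.card_eq_numComponents {C : Finset F.Circuit} (hC : F.IsEulerSystem C) :
    C.card = F.numComponents := by
  choose e he _ using hC.2
  have hinj : Function.Injective fun K => (⟨e K, (he K).1⟩ : C) := by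
    intro K K' hKK'
    have hKK' : e K = e K' := congrArg Subtype.val hKK'
    obtain ⟨h, hh⟩ := (e K).exists_traverses
    rw [← ((he K).2 h).1 hh, ((he K').2 h).1 (hKK' ▸ hh)]
  have hsurj : Function.Surjective fun K => (⟨e K, (he K).1⟩ : C) := by
    rintro ⟨γ, hγ⟩
    obtain ⟨K, hK⟩ := hC.1 γ hγ
    exact ⟨K, Subtype.ext ((hC.2 K).unique (he K) ⟨hγ, hK⟩)⟩
  rw [numComponents, Nat.card_congr (Equiv.ofBijective _ ⟨hinj, hsurj⟩), Nat.card_eq_fintype_card,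
    Fintype.card_coe]

/-- Data attached to directions of the circuits of an Euler system `C` of a 4-regular graph:
`ρ` is the transition of `C`, the half-edges with `out h` are the initial ones, and `κ` pairs
the two initial half-edges and the two terminal half-edges at every vertex. -/
structure IsEulerFrame (C : Finset F.Circuit) (ρ κ : H → H) (out : H → Prop) : Prop where
  rho : F.IsTransition ρ
  hasTransition : HasTransition C ρ
  kappa : F.IsTransition κ
  comm : ∀ h, κ (ρ h) = ρ (κ h)
  out_mate : ∀ h, out (F.mate h) ↔ ¬ out h
  out_rho : ∀ h, out (ρ h) ↔ ¬ out h
  out_kappa : ∀ h, out (κ h) ↔ out h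
  directs : ∀ a b, F.vert b = F.vert a → ((∃ γ ∈ C, γ.Directs a b) ↔ (out a ↔ ¬ out b))
  cover : ∀ a h, F.vert a = F.vert h → a = h ∨ a = ρ h ∨ a = κ h ∨ a = ρ (κ h)
  uniform : ∀ γ ∈ C, ∀ c : F.OrientedCircuit, c.IsOrientationOf γ → ∀ a ∈ c.1, ∀ b ∈ c.1,
    (out a ↔ out b)

theorem IsEulerSystem.exists_directions {C : Finset F.Circuit} (hC : F.IsEulerSystem C)
    {ρ : H → H} (hρ : F.IsTransition ρ) (hCρ : HasTransition C ρ) :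
    ∃ out : H → Prop, (∀ h, out (F.mate h) ↔ ¬ out h) ∧ (∀ h, out (ρ h) ↔ ¬ out h) ∧
      (∀ a b, F.vert b = F.vert a → ((∃ γ ∈ C, γ.Directs a b) ↔ (out a ↔ ¬ out b))) ∧
      ∀ γ ∈ C, ∀ c : F.OrientedCircuit, c.IsOrientationOf γ → ∀ a ∈ c.1, ∀ b ∈ c.1,
        (out a ↔ out b) := by
  have hP := hC.isCircuitPartition
  choose o ho using fun γ : F.Circuit => γ.exists_orientation
  have hout : ∀ γ ∈ C, ∀ h, γ.Traverses h → ((∃ γ ∈ C, h ∈ (o γ).1) ↔ h ∈ (o γ).1) := by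
    intro γ hγ h ht
    refine ⟨fun ⟨γ', hγ', hh⟩ => ?_, fun hh => ⟨γ, hγ, hh⟩⟩
    rwa [(hP h).unique ⟨hγ, ht⟩ ⟨hγ', o γ', ho γ', Or.inl hh⟩]
  have hmate : ∀ (c : F.OrientedCircuit) γ, c.IsOrientationOf γ → ∀ h, γ.Traverses h →
      (F.mate h ∈ c.1 ↔ ¬ h ∈ c.1) := by
    intro c γ hc h ht
    refine ⟨fun h₁ h₂ => c.2.2.2.2 h h₂ h₁, fun h₁ => ?_⟩
    exact ((Circuit.traverses_iff_of_isOrientationOf hc).1 ht).resolve_left h₁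
  -- With the orientations `o γ` fixed, the outgoing half-edges are those listed in them. For
  -- `Directs` the choice is immaterial: all half-edges at a vertex lie on one circuit, whose
  -- reversal flips all of them.
  refine ⟨fun h => ∃ γ ∈ C, h ∈ (o γ).1, fun h => ?_, fun h => ?_, fun a b hab => ?_, ?_⟩
  · obtain ⟨γ, ⟨hγ, ht⟩, -⟩ := hP h
    dsimp only
    rw [hout γ hγ h ht, hout γ hγ _ (Circuit.traverses_mate.2 ht), hmate _ γ (ho γ) h ht]
  · obtain ⟨γ, ⟨hγ, ht⟩, -⟩ := hP h
    have ht' := hC.traverses_of_vert_eq hγ (hρ.vert h) ht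
    dsimp only
    rw [hout γ hγ h ht, hout γ hγ _ ht', ← hmate _ γ (ho γ) h ht]
    have step : ∀ c : F.OrientedCircuit, c.IsOrientationOf γ → ∀ a, F.mate a ∈ c.1 →
        ρ a ∈ c.1 := by
      intro c hc a ha
      obtain ⟨b, hb, e⟩ := (hCρ.uses hγ hc).rel_of_mem ha
      rwa [e, F.mate_mate] at hb
    -- The other implication is the same step along the reversed circuit.
    refine ⟨fun hr => ?_, step _ (ho γ) h⟩
    have := step (o γ).rev (ho γ).rev (ρ h) (mem_rev.2 (by rwa [F.mate_mate]))
    rw [hρ.invol] at this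
    exact mem_rev.1 this
  · obtain ⟨γ, ⟨hγ, ht⟩, -⟩ := hP a
    have ht' := hC.traverses_of_vert_eq hγ hab ht
    dsimp only
    rw [hout γ hγ a ht, hout γ hγ b ht']
    constructor
    · rintro ⟨γ', hγ', c, hc, ha, hb⟩
      obtain rfl := (hP a).unique ⟨hγ, ht⟩ ⟨hγ', c, hc, Or.inr ha⟩
      rw [hmate c γ hc a ht] at ha
      rcases (ho γ).eq_or_eq_rev hc with e | e
      · rw [e] at ha hb
        exact iff_of_false ha (not_not.2 hb)
      · rw [e, mem_rev] at ha hb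
        rw [hmate _ γ (ho γ) a ht, not_not] at ha
        rw [hmate _ γ (ho γ) b ht'] at hb
        exact iff_of_true ha hb
    · intro hab'
      by_cases hb : b ∈ (o γ).1
      · refine ⟨γ, hγ, o γ, ho γ, ?_, hb⟩
        rw [hmate _ γ (ho γ) a ht]
        tauto
      · refine ⟨γ, hγ, (o γ).rev, (ho γ).rev, ?_, mem_rev.2 ((hmate _ γ (ho γ) b ht').2 hb)⟩
        exact mem_rev.2 (by rw [F.mate_mate]; tauto)
  · intro γ hγ c hc a ha b hb
    have hta : γ.Traverses a := ⟨c, hc, Or.inl ha⟩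
    have htb : γ.Traverses b := ⟨c, hc, Or.inl hb⟩
    dsimp only
    rw [hout γ hγ a hta, hout γ hγ b htb]
    rcases (ho γ).eq_or_eq_rev hc with e | e
    · rw [e] at ha hb
      exact iff_of_true ha hb
    · rw [e, mem_rev] at ha hb
      exact iff_of_false ((hmate _ γ (ho γ) a hta).1 ha) ((hmate _ γ (ho γ) b htb).1 hb)

/-- As `ρ` reverses directions, two of the four half-edges at a vertex are outgoing and two
incoming; `κ` exchanges the two with equal direction. -/
theorem exists_twin [Finite H] (hF : F.IsRegular 4) {ρ : H → H} (hρ : F.IsTransition ρ)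
    {out : H → Prop} (hout : ∀ h, out (ρ h) ↔ ¬ out h) :
    ∃ κ, F.IsTransition κ ∧ (∀ h, κ (ρ h) = ρ (κ h)) ∧ (∀ h, out (κ h) ↔ out h) ∧
      ∀ a h, F.vert a = F.vert h → a = h ∨ a = ρ h ∨ a = κ h ∨ a = ρ (κ h) := by
  classical
  have hex : ∀ h, ∃ b, F.vert b = F.vert h ∧ b ≠ h ∧ (out b ↔ out h) := by
    intro h
    obtain ⟨b, hb, hb'⟩ : ∃ b ∈ {a | F.vert a = F.vert h}, b ∉ ({h, ρ h} : Set H) := by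
      refine Set.exists_mem_notMem_of_ncard_lt_ncard ?_ (Set.toFinite _)
      rw [hF]
      exact (Set.ncard_insert_le _ _).trans_lt (by simp)
    simp only [Set.mem_insert_iff, Set.mem_singleton_iff, not_or] at hb'
    by_cases ho : out b ↔ out h
    · exact ⟨b, hb, hb'.1, ho⟩
    · refine ⟨ρ b, (hρ.vert b).trans hb, fun e => hb'.2 ?_, ?_⟩
      · rw [← e, hρ.invol]
      · rw [hout]; tauto
  choose κ hv hne ho using hex
  have huniq : ∀ h c, F.vert c = F.vert h → c ≠ h → (out c ↔ out h) → c = κ h := by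
    intro h c hc hch hco
    by_contra hck
    have hd : ∀ a b, (out a ↔ out b) → a ≠ ρ b := by
      rintro a b hab rfl
      rw [hout] at hab
      tauto
    have hρi : ∀ a b, ρ a = ρ b ↔ a = b := fun a b =>
      (Function.LeftInverse.injective hρ.invol).eq_iff
    -- A third half-edge `c` with the direction of `h` would give five half-edges at one vertex.
    have hcard : ({h, κ h, c, ρ h, ρ (κ h)} : Finset H).card = 5 := by
      rw [Finset.card_insert_of_notMem, Finset.card_insert_of_notMem,
        Finset.card_insert_of_notMem, Finset.card_insert_of_notMem, Finset.card_singleton]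
      · simp [hρi, (hne h).symm]
      · simp [hd c h hco, hd c (κ h) (hco.trans (ho h).symm)]
      · simp [Ne.symm hck, hd (κ h) h (ho h), hd (κ h) (κ h) Iff.rfl]
      · simp [(hne h).symm, hch.symm, hd h h Iff.rfl, hd h (κ h) (ho h).symm]
    have hle : (({h, κ h, c, ρ h, ρ (κ h)} : Finset H) : Set H).ncard ≤
        {a | F.vert a = F.vert h}.ncard := by
      refine Set.ncard_le_ncard ?_ (Set.toFinite _)
      intro a ha
      simp only [Finset.coe_insert, Finset.coe_singleton, Set.mem_insert_iff,
        Set.mem_singleton_iff] at ha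
      rcases ha with rfl | rfl | rfl | rfl | rfl <;> simp [hρ.vert, hv, hc]
    rw [Set.ncard_coe_finset, hcard, hF] at hle
    omega
  refine ⟨κ, ⟨fun h => ?_, hne, hv⟩, fun h => ?_, ho, fun a h hah => ?_⟩
  · by_contra hne'
    exact hne (κ h) (huniq h _ ((hv _).trans (hv h)) hne' ((ho _).trans (ho h)))
  · rw [← huniq h (ρ (κ (ρ h))), hρ.invol]
    · rw [hρ.vert, hv, hρ.vert]
    · intro e
      apply hne (ρ h)
      rw [← hρ.invol (κ (ρ h)), e]
    · rw [hout, ho, hout, not_not]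
  · by_cases hao : out a ↔ out h
    · by_cases e : a = h
      · exact Or.inl e
      · exact Or.inr (Or.inr (Or.inl (huniq h a hah e hao)))
    · by_cases e : ρ a = h
      · exact Or.inr (Or.inl (by rw [← e, hρ.invol]))
      · refine Or.inr (Or.inr (Or.inr ?_))
        rw [← huniq h (ρ a) ((hρ.vert a).trans hah) e (by rw [hout]; tauto), hρ.invol]

theorem IsEulerSystem.exists_frame [Finite H] (hF : F.IsRegular 4) {C : Finset F.Circuit}
    (hC : F.IsEulerSystem C) : ∃ ρ κ out, IsEulerFrame C ρ κ out := by
  obtain ⟨ρ, hρ, hCρ⟩ := hC.isCircuitPartition.exists_hasTransition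
  obtain ⟨out, h₁, h₂, h₃, h₄⟩ := hC.exists_directions hρ hCρ
  obtain ⟨κ, k₁, k₂, k₃, k₄⟩ := exists_twin hF hρ h₂
  exact ⟨ρ, κ, out, hρ, hCρ, k₁, k₂, h₁, h₂, k₃, h₃, k₄, h₄⟩

/-! ### The three transitions at a vertex and their names. -/

/-- The transitions with prescribed names relative to `ρ` and `κ`. -/
def labelTransition (F : HalfEdgeGraph V H) (ρ κ : H → H) (P : LabeledPartition V) (h : H) : H :=
  match P (F.vert h) with
  | PartLabel.phi => ρ h
  | PartLabel.chi => ρ (κ h)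
  | PartLabel.psi => κ h

section labelTransition

variable {ρ κ : H → H} {P : LabeledPartition V} {h : H}

theorem labelTransition_phi (hP : P (F.vert h) = PartLabel.phi) :
    F.labelTransition ρ κ P h = ρ h := by rw [labelTransition, hP]

theorem labelTransition_chi (hP : P (F.vert h) = PartLabel.chi) :
    F.labelTransition ρ κ P h = ρ (κ h) := by rw [labelTransition, hP]

theorem labelTransition_psi (hP : P (F.vert h) = PartLabel.psi) :
    F.labelTransition ρ κ P h = κ h := by rw [labelTransition, hP]

end labelTransition

namespace IsEulerFrame

variable {C : Finset F.Circuit} {ρ κ : H → H} {out : H → Prop}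

theorem rho_ne_kappa (hf : IsEulerFrame C ρ κ out) (h : H) : ρ h ≠ κ h := fun e => by
  have := hf.out_rho h
  rw [e, hf.out_kappa] at this
  tauto

theorem rho_kappa_ne (hf : IsEulerFrame C ρ κ out) (h : H) : ρ (κ h) ≠ h := fun e => by
  have := hf.out_rho (κ h)
  rw [e, hf.out_kappa] at this
  tauto

theorem isTransition_labelTransition (hf : IsEulerFrame C ρ κ out) (P : LabeledPartition V) :
    F.IsTransition (F.labelTransition ρ κ P) := by
  have hv : ∀ h, F.vert (F.labelTransition ρ κ P h) = F.vert h := by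
    intro h
    rcases hP : P (F.vert h) with _ | _ | _
    · rw [labelTransition_phi hP, hf.rho.vert]
    · rw [labelTransition_chi hP, hf.rho.vert, hf.kappa.vert]
    · rw [labelTransition_psi hP, hf.kappa.vert]
  refine ⟨fun h => ?_, fun h => ?_, hv⟩
  · rcases hP : P (F.vert h) with _ | _ | _
    · rw [labelTransition_phi (by rw [hv, hP]), labelTransition_phi hP, hf.rho.invol]
    · rw [labelTransition_chi (by rw [hv, hP]), labelTransition_chi hP, hf.comm, hf.kappa.invol,
        hf.rho.invol]
    · rw [labelTransition_psi (by rw [hv, hP]), labelTransition_psi hP, hf.kappa.invol]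
  · rcases hP : P (F.vert h) with _ | _ | _
    · rw [labelTransition_phi hP]; exact hf.rho.ne h
    · rw [labelTransition_chi hP]; exact hf.rho_kappa_ne h
    · rw [labelTransition_psi hP]; exact hf.kappa.ne h

/-- A fixed-point-free involution of four elements is determined by the image of one of them, so one
half-edge per vertex decides the label. -/
theorem exists_eq_labelTransition (hf : IsEulerFrame C ρ κ out) {τ : H → H}
    (hτ : F.IsTransition τ) : ∃ P, τ = F.labelTransition ρ κ P := by
  have key : ∀ v : V, ∃ p : PartLabel, ∀ h, F.vert h = v →
      τ h = F.labelTransition ρ κ (fun _ => p) h := by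
    intro v
    by_cases hv : ∃ h, F.vert h = v
    · obtain ⟨h, rfl⟩ := hv
      suffices hs : ∃ p : PartLabel, τ h = F.labelTransition ρ κ (fun _ => p) h by
        obtain ⟨p, hp⟩ := hs
        set σ := F.labelTransition ρ κ (fun _ => p) with hσ
        have hσt : F.IsTransition σ := hf.isTransition_labelTransition _
        have hσh : τ (σ h) = σ (σ h) := by rw [← hp, hτ.invol, hp, hσt.invol]
        have hinj := Function.LeftInverse.injective hτ.invol
        refine ⟨p, fun a ha => ?_⟩
        by_cases e₁ : a = h
        · rw [e₁, hp]
        by_cases e₂ : a = σ h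
        · rw [e₂, hσh]
        have n₁ : τ a ≠ h := fun e => e₂ (by rw [← hp, ← e, hτ.invol])
        have n₂ : τ a ≠ σ h := fun e => e₁ (hinj (by rw [e, hp]))
        have n₃ : τ a ≠ a := hτ.ne a
        have m₁ : σ a ≠ h := fun e => e₂ (by rw [← e, hσt.invol])
        have m₂ : σ a ≠ σ h := fun e => e₁ ((Function.LeftInverse.injective hσt.invol) e)
        have m₃ : σ a ≠ a := hσt.ne a
        have c₁ := hf.cover (τ a) h ((hτ.vert a).trans ha)
        have c₂ := hf.cover (σ a) h ((hσt.vert a).trans ha)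
        have c₃ := hf.cover a h ha
        have c₄ : σ h = ρ h ∨ σ h = κ h ∨ σ h = ρ (κ h) := by
          have := hf.cover (σ h) h (hσt.vert h)
          have := hσt.ne h
          tauto
        grind
      have := hf.cover (τ h) h (hτ.vert h)
      rcases this with e | e | e | e
      · exact absurd e (hτ.ne h)
      · exact ⟨PartLabel.phi, e⟩
      · exact ⟨PartLabel.psi, e⟩
      · exact ⟨PartLabel.chi, e⟩
    -- At a vertex without half-edges any label would do.
    · exact ⟨PartLabel.phi, fun h hh => absurd ⟨h, hh⟩ hv⟩
  choose P hP using key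
  exact ⟨P, funext fun h => hP _ h rfl⟩

theorem followsAt_iff (hf : IsEulerFrame C ρ κ out) {Q : Finset F.Circuit}
    {P : LabeledPartition V} (hQ : HasTransition Q (F.labelTransition ρ κ P)) (h : H) :
    FollowsAt Q C (F.vert h) ↔ P (F.vert h) = PartLabel.phi := by
  constructor
  · intro hfol
    have := (hfol h (ρ h) rfl (hf.rho.vert h)).2 ((hf.hasTransition _ _).2 rfl)
    rw [hQ] at this
    rcases hP : P (F.vert h) with _ | _ | _
    · rfl
    · rw [labelTransition_chi hP] at this
      exact absurd ((Function.LeftInverse.injective hf.rho.invol) this).symm (hf.kappa.ne h)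
    · rw [labelTransition_psi hP] at this
      exact absurd this (hf.rho_ne_kappa h)
  · intro hP a b ha _
    rw [hQ, hf.hasTransition, labelTransition_phi (by rw [ha, hP])]

theorem consistentAt_iff (hf : IsEulerFrame C ρ κ out) {Q : Finset F.Circuit}
    {P : LabeledPartition V} (hQ : HasTransition Q (F.labelTransition ρ κ P)) (h : H) :
    ConsistentAt Q C (F.vert h) ↔ P (F.vert h) ≠ PartLabel.psi := by
  constructor
  · intro hcon hP
    have := hcon h (κ h) rfl (hf.kappa.vert h) ((hQ _ _).2 (labelTransition_psi hP).symm)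
    rw [hf.directs _ _ (hf.kappa.vert h), hf.out_kappa] at this
    tauto
  · intro hP a b ha hb hab
    rw [hf.directs _ _ (hb.trans ha.symm)]
    rw [hQ] at hab
    rcases hP' : P (F.vert a) with _ | _ | _
    · rw [hab, labelTransition_phi hP', hf.out_rho, not_not]
    · rw [hab, labelTransition_chi hP', hf.out_rho, hf.out_kappa, not_not]
    · exact absurd (ha ▸ hP') hP

end IsEulerFrame

/-! ### Counting circuits by a dimension over GF(2). -/

/-- The `GF(2)`-valued functions on the edges that are constant along the transitions `τ`. -/
def invariants (F : HalfEdgeGraph V H) (τ : H → H) : Submodule (ZMod 2) (H → ZMod 2) where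
  carrier := {f | (∀ h, f (F.mate h) = f h) ∧ ∀ h, f (τ h) = f h}
  add_mem' := fun hf hg => ⟨fun h => by simp [hf.1, hg.1], fun h => by simp [hf.2, hg.2]⟩
  zero_mem' := ⟨fun _ => rfl, fun _ => rfl⟩
  smul_mem' := fun r f hf => ⟨fun h => by simp [hf.1], fun h => by simp [hf.2]⟩

theorem HasTransition.apply_eq_of_traverses {P : Finset F.Circuit} {τ : H → H}
    (h : HasTransition P τ) {f : H → ZMod 2} (hf : f ∈ F.invariants τ) {γ : F.Circuit}
    (hγ : γ ∈ P) {a b : H} (ha : γ.Traverses a) (hb : γ.Traverses b) : f a = f b := by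
  obtain ⟨c, hc, hac⟩ := ha.exists_mem
  have hch : c.1.Chain fun a b => f a = f b := (h.uses hγ hc).imp fun a b e => by
    rw [e, hf.2, hf.1]
  have : IsTrans H fun a b => f a = f b := ⟨fun _ _ _ => Eq.trans⟩
  rw [Cycle.chain_iff_pairwise] at hch
  rcases (Circuit.traverses_iff_of_isOrientationOf hc).1 hb with hb | hb
  · exact hch a hac b hb
  · rw [hch a hac _ hb, hf.1]

/-- Invariant functions are those constant on each circuit, that is, the pullbacks of functions on
`P` along the map taking a half-edge to its circuit. -/
theorem HasTransition.finrank_invariants {P : Finset F.Circuit} {τ : H → H}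
    (h : HasTransition P τ) (hP : F.IsCircuitPartition P) :
    Module.finrank (ZMod 2) (F.invariants τ) = P.card := by
  choose e he hu using hP
  have heq : ∀ {a γ}, γ ∈ P → γ.Traverses a → e a = γ := fun hγ ht => (hu _ _ ⟨hγ, ht⟩).symm
  let E : H → P := fun a => ⟨e a, (he a).1⟩
  have hτ : ∀ a, e (τ a) = e a := fun a => by
    obtain ⟨γ, hγ, hp⟩ := (h a (τ a)).2 rfl
    rw [heq hγ hp.traverses_left, heq hγ hp.symm.traverses_left]
  have hm : ∀ a, e (F.mate a) = e a := fun a =>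
    heq (he a).1 (Circuit.traverses_mate.2 (he a).2)
  let L : (P → ZMod 2) →ₗ[ZMod 2] F.invariants τ :=
    (LinearMap.funLeft (ZMod 2) (ZMod 2) E).codRestrict (F.invariants τ) fun u =>
      ⟨fun a => congrArg u (Subtype.ext (hm a)), fun a => congrArg u (Subtype.ext (hτ a))⟩
  have hL : Function.Bijective L := by
    constructor
    · intro u u' huu
      ext ⟨γ, hγ⟩
      obtain ⟨a, ha⟩ := γ.exists_traverses
      have : E a = ⟨γ, hγ⟩ := Subtype.ext (heq hγ ha)
      rw [← this]
      exact congrFun (congrArg Subtype.val huu) a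
    · rintro ⟨f, hf⟩
      choose r hr using fun γ : F.Circuit => γ.exists_traverses
      refine ⟨fun γ => f (r γ.1), Subtype.ext (funext fun a => ?_)⟩
      exact h.apply_eq_of_traverses hf (he a).1 (hr _) (he a).2
  rw [← (LinearEquiv.ofBijective L hL).finrank_eq, Module.finrank_fintype_fun_eq_card,
    Fintype.card_coe]

/-! ### Arcs of Euler circuits and interlacement. -/

open Classical in
/-- The indicator function of the edges that meet `s`. -/
noncomputable def edgeIndicator (F : HalfEdgeGraph V H) (s : List H) (h : H) : ZMod 2 :=
  if h ∈ s ∨ F.mate h ∈ s then 1 else 0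

theorem edgeIndicator_mate (s : List H) (h : H) :
    F.edgeIndicator s (F.mate h) = F.edgeIndicator s h := by
  classical
  exact if_congr (by rw [F.mate_mate, or_comm]) rfl rfl

end HalfEdgeGraph

/-- Applied to an arc `l` whose complementary arc begins with `y`: the successor of an entry is a
later entry of the arc or `y`. -/
theorem List.IsChain.exists_mem_rel {α : Type*} {r : α → α → Prop} {l : List α} {y a : α}
    (h : (l ++ [y]).IsChain r) (ha : a ∈ l) : ∃ b ∈ l.tail ++ [y], r a b := by
  obtain ⟨s, t, rfl⟩ := List.append_of_mem ha
  rw [List.append_assoc, List.cons_append] at h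
  have h := h.right_of_append
  cases t with
  | nil => exact ⟨y, by simp, (List.isChain_cons_cons.1 h).1⟩
  | cons b t =>
    refine ⟨b, ?_, (List.isChain_cons_cons.1 h).1⟩
    cases s <;> simp

namespace HalfEdgeGraph

variable {V H : Type*} {F : HalfEdgeGraph V H}

namespace IsEulerFrame

variable {C : Finset F.Circuit} {ρ κ : H → H} {out : H → Prop}

theorem eq_or_eq_kappa (hf : IsEulerFrame C ρ κ out) {a b : H} (hv : F.vert a = F.vert b)
    (ho : out a ↔ out b) : a = b ∨ a = κ b := by
  rcases hf.cover a b hv with e | e | e | e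
  · exact Or.inl e
  · rw [e, hf.out_rho] at ho; tauto
  · exact Or.inr e
  · rw [e, hf.out_rho, hf.out_kappa] at ho; tauto

-- Along the Euler circuit the indicator of the arc from `x` up to `y` changes only where the arc is
-- entered or left, and both happen at the vertex of `x`.
open Classical in
theorem edgeIndicator_add_rho (hf : IsEulerFrame C ρ κ out) (hC : F.IsEulerSystem C)
    {γ : F.Circuit} (hγ : γ ∈ C) {c : F.OrientedCircuit} (hc : c.IsOrientationOf γ) {x y : H}
    {A B : List H} (hl : c.1 = ((x :: A ++ y :: B : List H) : Cycle H))
    (hxy : F.vert y = F.vert x) (h : H) :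
    F.edgeIndicator (x :: A) h + F.edgeIndicator (x :: A) (ρ h) =
      if F.vert h = F.vert x then 1 else 0 := by
  have hmem : ∀ a, a ∈ c.1 ↔ a ∈ x :: A ∨ a ∈ y :: B := fun a => by
    rw [hl, Cycle.mem_coe_iff, List.mem_append]
  have hnd : (x :: A ++ y :: B).Nodup := by
    have := c.2.2.2.1
    rwa [hl, Cycle.nodup_coe_iff] at this
  have hdis : ∀ a, a ∈ x :: A → a ∉ y :: B := fun a h₁ h₂ =>
    (List.nodup_append.1 hnd).2.2 a h₁ a h₂ rfl
  have hxA : x ∉ A := (List.nodup_cons.1 (List.nodup_append.1 hnd).1).1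
  have hyB : y ∉ B := (List.nodup_cons.1 (List.nodup_append.1 hnd).2.1).1
  have hx : x ∈ c.1 := (hmem x).2 (Or.inl List.mem_cons_self)
  have hy : y ∈ c.1 := (hmem y).2 (Or.inr List.mem_cons_self)
  -- All entries of `c` have the same direction, and only two half-edges at the vertex have it.
  have hvx : ∀ b ∈ c.1, (F.vert b = F.vert x ↔ b = x ∨ b = y) := by
    intro b hb
    refine ⟨fun e => ?_, ?_⟩
    · have e₁ := hf.eq_or_eq_kappa e (hf.uniform γ hγ c hc b hb x hx)
      have e₂ := hf.eq_or_eq_kappa hxy (hf.uniform γ hγ c hc y hy x hx)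
      have : y ≠ x := fun e => hdis x List.mem_cons_self (by rw [e]; exact List.mem_cons_self)
      grind
    · rintro (rfl | rfl)
      · rfl
      · exact hxy
  have hchain : (x :: A ++ y :: (B ++ [x])).IsChain fun a b => b = ρ (F.mate a) := by
    have := hf.hasTransition.uses hγ hc
    rw [Uses, hl, List.cons_append, Cycle.chain_coe_cons] at this
    simpa using this
  rw [List.isChain_split] at hchain
  have hind : ∀ a ∈ c.1, (F.edgeIndicator (x :: A) a = if a ∈ x :: A then 1 else 0) := by
    intro a ha
    have : F.mate a ∉ x :: A := fun hm => c.2.2.2.2 a ha ((hmem _).2 (Or.inl hm))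
    simp [edgeIndicator, this]
  have step : ∀ a ∈ c.1, ∀ b ∈ c.1, b = ρ (F.mate a) →
      F.edgeIndicator (x :: A) a + F.edgeIndicator (x :: A) b =
        if F.vert b = F.vert x then 1 else 0 := by
    intro a ha b hb hab
    simp only [hind a ha, hind b hb, hvx b hb]
    rcases (hmem a).1 ha with h₁ | h₁
    · obtain ⟨b', hb', e⟩ := hchain.1.exists_mem_rel h₁
      obtain rfl : b = b' := hab.trans e.symm
      rw [List.tail_cons, List.mem_append, List.mem_singleton] at hb'
      rcases hb' with hb' | rfl
      · have h₂ : b ∈ x :: A := List.mem_cons_of_mem _ hb'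
        have h₃ : ¬ (b = x ∨ b = y) := by
          rintro (rfl | rfl)
          · exact hxA hb'
          · exact hdis _ h₂ List.mem_cons_self
        rw [if_pos h₁, if_pos h₂, if_neg h₃]; rfl
      · rw [if_pos h₁, if_neg fun h => hdis _ h List.mem_cons_self, if_pos (Or.inr rfl), add_zero]
    · obtain ⟨b', hb', e⟩ := List.IsChain.exists_mem_rel (l := y :: B) hchain.2 h₁
      obtain rfl : b = b' := hab.trans e.symm
      rw [List.tail_cons, List.mem_append, List.mem_singleton] at hb'
      rw [if_neg fun h => hdis _ h h₁, zero_add]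
      rcases hb' with hb' | rfl
      · have h₂ : b ∉ x :: A := fun h => hdis _ h (List.mem_cons_of_mem _ hb')
        have h₃ : ¬ (b = x ∨ b = y) := by
          rintro (rfl | rfl)
          · exact h₂ List.mem_cons_self
          · exact hyB hb'
        rw [if_neg h₂, if_neg h₃]
      · rw [if_pos List.mem_cons_self, if_pos (Or.inl rfl)]
  have stepmem : ∀ a, F.mate a ∈ c.1 → ρ a ∈ c.1 := by
    intro a ha
    obtain ⟨b, hb, e⟩ := (hf.hasTransition.uses hγ hc).rel_of_mem ha
    rwa [e, F.mate_mate] at hb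
  have half : ∀ h, F.mate h ∈ c.1 → F.edgeIndicator (x :: A) h + F.edgeIndicator (x :: A) (ρ h) =
      if F.vert h = F.vert x then 1 else 0 := by
    intro h hm
    have := step _ hm _ (stepmem h hm) (by rw [F.mate_mate])
    rwa [edgeIndicator_mate, hf.rho.vert] at this
  -- One of `h` and `ρ h` is incoming for `c`, and the claim is symmetric in them; off `γ` both
  -- sides vanish.
  by_cases ht : γ.Traverses h
  · rcases (Circuit.traverses_iff_of_isOrientationOf hc).1 ht with hh | hh
    · have hr := hC.traverses_of_vert_eq hγ (hf.rho.vert h) ht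
      rcases (Circuit.traverses_iff_of_isOrientationOf hc).1 hr with hr | hr
      · have := hf.uniform γ hγ c hc _ hr _ hh
        rw [hf.out_rho] at this
        tauto
      · have := half _ hr
        rwa [hf.rho.invol, hf.rho.vert, add_comm] at this
    · exact half h hh
  · have hr : ¬ γ.Traverses (ρ h) := fun hr =>
      ht (hC.traverses_of_vert_eq hγ (hf.rho.vert h).symm hr)
    have hz : ∀ a, ¬ γ.Traverses a → F.edgeIndicator (x :: A) a = 0 := by
      intro a ha
      rw [edgeIndicator, if_neg]
      intro hm
      exact ha ⟨c, hc, hm.imp (fun h => (hmem _).2 (Or.inl h)) fun h => (hmem _).2 (Or.inl h)⟩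
    have hv : F.vert h ≠ F.vert x := fun e =>
      ht (hC.traverses_of_vert_eq hγ e ⟨c, hc, Or.inl hx⟩)
    rw [hz _ ht, hz _ hr, if_neg hv, add_zero]

/-- Applying `ρ` adds the same g(v) to both summands, and applying `κ` exchanges them. -/
theorem add_kappa_eq_of_vert_eq (hf : IsEulerFrame C ρ κ out) {f : H → ZMod 2} {g : V → ZMod 2}
    (hfg : ∀ h, f h + f (ρ h) = g (F.vert h)) {p q : H} (hpq : F.vert q = F.vert p) :
    f q + f (κ q) = f p + f (κ p) := by
  have h₁ := hfg p
  have h₂ := hfg (κ p)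
  rw [hf.kappa.vert] at h₂
  rcases hf.cover q p hpq with rfl | rfl | rfl | rfl
  · rfl
  · rw [hf.comm]
    generalize g (F.vert p) = r, f p = a, f (ρ p) = b, f (κ p) = c, f (ρ (κ p)) = d at *
    revert a b c d r; decide
  · rw [hf.kappa.invol, add_comm]
  · rw [hf.comm, hf.kappa.invol]
    generalize g (F.vert p) = r, f p = a, f (ρ p) = b, f (κ p) = c, f (ρ (κ p)) = d at *
    revert a b c d r; decide

theorem apply_eq_of_mem_invariants (hf : IsEulerFrame C ρ κ out) (hC : F.IsEulerSystem C)
    {f : H → ZMod 2} (h : f ∈ F.invariants ρ) {p q : H} (hpq : F.vert q = F.vert p) :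
    f q = f p := by
  obtain ⟨γ, ⟨hγ, ht⟩, -⟩ := hC.isCircuitPartition p
  exact hf.hasTransition.apply_eq_of_traverses h hγ (hC.traverses_of_vert_eq hγ hpq ht) ht

/-- Edge functions with equal derivatives differ by a `ρ`-invariant function, which takes one value
at each vertex. A computation with one integral is therefore valid for all of them. -/
theorem add_kappa_congr (hf : IsEulerFrame C ρ κ out) (hC : F.IsEulerSystem C)
    {f f' : H → ZMod 2} (hm : ∀ h, f (F.mate h) = f h) (hm' : ∀ h, f' (F.mate h) = f' h)
    (hff : ∀ h, f h + f (ρ h) = f' h + f' (ρ h)) (p : H) :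
    f p + f (κ p) = f' p + f' (κ p) := by
  have : f + f' ∈ F.invariants ρ := by
    refine ⟨fun h => by simp [hm, hm'], fun h => ?_⟩
    have := hff h
    simp only [Pi.add_apply]
    generalize f h = a, f (ρ h) = b, f' h = c, f' (ρ h) = d at *
    revert a b c d; decide
  have := hf.apply_eq_of_mem_invariants hC this (hf.kappa.vert p)
  simp only [Pi.add_apply] at this
  generalize f p = a, f (κ p) = b, f' p = c, f' (κ p) = d at *
  revert a b c d; decide

-- By `add_kappa_congr`, `f` may be replaced by the indicator of an arc between the two passages
-- through `v`. Interlacement puts exactly one of the two passages through the other vertex on that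
-- arc.
open Classical in
theorem add_kappa_eq_one_of_adj (hf : IsEulerFrame C ρ κ out) (hC : F.IsEulerSystem C)
    {f : H → ZMod 2} {v : V} (hm : ∀ h, f (F.mate h) = f h)
    (hfv : ∀ h, f h + f (ρ h) = if F.vert h = v then 1 else 0) {p : H}
    (hadj : (interlacementGraph C).Adj v (F.vert p)) : f p + f (κ p) = 1 := by
  obtain ⟨-, γ, hγ, c, hc, l, hl, hs⟩ := hadj
  obtain ⟨l', hl', e⟩ := List.sublist_map_iff.1 hs
  obtain ⟨x, t₁, rfl, hx, e⟩ := List.map_eq_cons_iff.1 e.symm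
  obtain ⟨q, t₂, rfl, hq, e⟩ := List.map_eq_cons_iff.1 e
  obtain ⟨y, t₃, rfl, hy, e⟩ := List.map_eq_cons_iff.1 e
  obtain ⟨r, t₄, rfl, hr, e⟩ := List.map_eq_cons_iff.1 e
  obtain rfl := List.map_eq_nil_iff.1 e
  obtain ⟨l₁, s₁, rfl, hx', hs₁⟩ := List.cons_sublist_iff.1 hl'
  obtain ⟨l₂, s₂, rfl, hq', hs₂⟩ := List.cons_sublist_iff.1 hs₁
  obtain ⟨l₃, s₃, rfl, hy', hs₃⟩ := List.cons_sublist_iff.1 hs₂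
  have hr' : r ∈ s₃ := List.singleton_sublist.1 hs₃
  obtain ⟨m₁, n₁, rfl⟩ := List.append_of_mem hx'
  obtain ⟨m₃, n₃, rfl⟩ := List.append_of_mem hy'
  -- The circuit is rotated to start at `x`; its first arc contains `q` and its second contains `r`.
  have hl'' : c.1 = ((x :: (n₁ ++ l₂ ++ m₃) ++ y :: (n₃ ++ s₃ ++ m₁) : List H) : Cycle H) := by
    rw [hl, Cycle.coe_eq_coe]
    have := List.isRotated_append (l := m₁) (l' := x :: (n₁ ++ l₂ ++ m₃ ++ y :: (n₃ ++ s₃)))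
    simpa using this
  have hnd : (x :: (n₁ ++ l₂ ++ m₃) ++ y :: (n₃ ++ s₃ ++ m₁)).Nodup := by
    have := c.2.2.2.1
    rwa [hl'', Cycle.nodup_coe_iff] at this
  have hq₁ : q ∈ x :: (n₁ ++ l₂ ++ m₃) := by simp [hq']
  have hr₁ : r ∉ x :: (n₁ ++ l₂ ++ m₃) := fun h =>
    (List.nodup_append.1 hnd).2.2 r h r (by simp [hr']) rfl
  have hqc : q ∈ c.1 := by
    rw [hl'', Cycle.mem_coe_iff]; exact List.mem_append_left _ hq₁
  have hrc : r ∈ c.1 := by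
    rw [hl'', Cycle.mem_coe_iff]; exact List.mem_append_right _ (by simp [hr'])
  have hrm : F.mate r ∉ x :: (n₁ ++ l₂ ++ m₃) := fun h => c.2.2.2.2 r hrc (by
    rw [hl'', Cycle.mem_coe_iff]; exact List.mem_append_left _ h)
  have hrq : r = κ q := by
    refine (hf.eq_or_eq_kappa (hr.trans hq.symm) (hf.uniform γ hγ c hc _ hrc _ hqc)).resolve_left
      fun e => hr₁ (e ▸ hq₁)
  have harc := hf.edgeIndicator_add_rho hC hγ hc hl'' (hy.trans hx.symm)
  rw [hx] at harc
  rw [← hf.add_kappa_eq_of_vert_eq (g := fun u => if u = v then 1 else 0) hfv hq,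
    hf.add_kappa_congr hC hm (edgeIndicator_mate _) (fun h => (hfv h).trans (harc h).symm) q,
    ← hrq]
  rw [edgeIndicator, edgeIndicator, if_pos (Or.inl hq₁), if_neg (not_or.2 ⟨hr₁, hrm⟩), add_zero]

theorem mem_of_out_iff (hf : IsEulerFrame C ρ κ out) {γ : F.Circuit} (hγ : γ ∈ C)
    {c : F.OrientedCircuit} (hc : c.IsOrientationOf γ) {a b : H} (ha : a ∈ c.1)
    (hb : γ.Traverses b) (hab : out b ↔ out a) : b ∈ c.1 := by
  rcases (Circuit.traverses_iff_of_isOrientationOf hc).1 hb with h | h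
  · exact h
  · have := hf.uniform γ hγ c hc _ h _ ha
    rw [hf.out_mate] at this
    tauto

-- The function is the indicator of the arc from `x` to `κ x`, the other departure from the same
-- vertex. It contains `x` but not `κ x`, and it separates `q` from `κ q` at another vertex exactly
-- under interlacement.
open Classical in
theorem exists_arc (hf : IsEulerFrame C ρ κ out) (hC : F.IsEulerSystem C) (x : H) :
    ∃ f : H → ZMod 2, (∀ h, f (F.mate h) = f h) ∧
      (∀ h, f h + f (ρ h) = if F.vert h = F.vert x then 1 else 0) ∧
      ∀ p, f p + f (κ p) = (if F.vert p = F.vert x then 1 else 0) +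
        if (interlacementGraph C).Adj (F.vert p) (F.vert x) then 1 else 0 := by
  obtain ⟨γ, ⟨hγ, htx⟩, -⟩ := hC.isCircuitPartition x
  obtain ⟨c, hc, hx⟩ := htx.exists_mem
  have hy : κ x ∈ c.1 := hf.mem_of_out_iff hγ hc hx
    (hC.traverses_of_vert_eq hγ (hf.kappa.vert x) htx) (hf.out_kappa x)
  obtain ⟨l, hl⟩ := Cycle.exists_coe_cons_of_mem hx
  rw [hl, Cycle.mem_coe_iff] at hy
  obtain ⟨A, B, rfl⟩ := List.append_of_mem ((List.mem_cons.1 hy).resolve_left (hf.kappa.ne x))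
  have hl' : c.1 = ((x :: A ++ κ x :: B : List H) : Cycle H) := hl
  have hmem : ∀ a, a ∈ c.1 ↔ a ∈ x :: A ∨ a ∈ κ x :: B := fun a => by
    rw [hl', Cycle.mem_coe_iff, List.mem_append]
  have hnd : (x :: A ++ κ x :: B).Nodup := by
    have := c.2.2.2.1
    rwa [hl', Cycle.nodup_coe_iff] at this
  have hdis : ∀ a, a ∈ x :: A → a ∉ κ x :: B := fun a h₁ h₂ =>
    (List.nodup_append.1 hnd).2.2 a h₁ a h₂ rfl
  have hind : ∀ a ∈ c.1, (F.edgeIndicator (x :: A) a = if a ∈ x :: A then 1 else 0) := by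
    intro a ha
    have : F.mate a ∉ x :: A := fun hm => c.2.2.2.2 a ha ((hmem _).2 (Or.inl hm))
    simp [edgeIndicator, this]
  have harc := hf.edgeIndicator_add_rho hC hγ hc hl' (hf.kappa.vert x)
  have hvert : ∀ p q, F.vert q = F.vert p → F.edgeIndicator (x :: A) q +
      F.edgeIndicator (x :: A) (κ q) = F.edgeIndicator (x :: A) p +
      F.edgeIndicator (x :: A) (κ p) := fun p q =>
    hf.add_kappa_eq_of_vert_eq (g := fun u => if u = F.vert x then 1 else 0) harc
  refine ⟨_, edgeIndicator_mate _, harc, fun p => ?_⟩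
  by_cases hpv : F.vert p = F.vert x
  · rw [hvert _ _ hpv, hpv, if_pos rfl, if_neg (SimpleGraph.irrefl _), hind x hx,
      hind _ ((hmem _).2 (Or.inr List.mem_cons_self)), if_pos List.mem_cons_self,
      if_neg fun h => hdis _ h List.mem_cons_self]
  rw [if_neg hpv, zero_add]
  by_cases hadj : (interlacementGraph C).Adj (F.vert p) (F.vert x)
  · rw [if_pos hadj]
    exact hf.add_kappa_eq_one_of_adj hC (edgeIndicator_mate _) harc hadj.symm
  rw [if_neg hadj]
  by_cases ht : γ.Traverses p
  -- Either `p` or `ρ p` has the direction of `c`.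
  · obtain ⟨q, hq, hqc⟩ : ∃ q, F.vert q = F.vert p ∧ q ∈ c.1 := by
      by_cases ho : out p ↔ out x
      · exact ⟨p, rfl, hf.mem_of_out_iff hγ hc hx ht ho⟩
      · refine ⟨ρ p, hf.rho.vert p, hf.mem_of_out_iff hγ hc hx
          (hC.traverses_of_vert_eq hγ (hf.rho.vert p) ht) ?_⟩
        rw [hf.out_rho]; tauto
    have hkc : κ q ∈ c.1 := hf.mem_of_out_iff hγ hc hqc
      (hC.traverses_of_vert_eq hγ (hf.kappa.vert q) ⟨c, hc, Or.inl hqc⟩) (hf.out_kappa q)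
    have hkv : F.vert (κ q) = F.vert p := (hf.kappa.vert q).trans hq
    -- Passages on different arcs give the order `x … a … κ x … b`, which is interlacement.
    have inter : ∀ a b, F.vert a = F.vert p → F.vert b = F.vert p → a ∈ x :: A →
        b ∈ κ x :: B → False := by
      intro a b ha hb haA hbB
      refine hadj (SimpleGraph.Adj.symm ⟨Ne.symm hpv, γ, hγ, c, hc, _, hl', ?_⟩)
      have haA : a ∈ A := (List.mem_cons.1 haA).resolve_left fun e => hpv (by rw [← ha, e])
      have hbB : b ∈ B := (List.mem_cons.1 hbB).resolve_left fun e => hpv (by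
        rw [← hb, e, hf.kappa.vert])
      have hs : ([x, a] ++ [κ x, b]).Sublist (x :: A ++ κ x :: B) :=
        ((List.singleton_sublist.2 haA).cons_cons x).append
          ((List.singleton_sublist.2 hbB).cons_cons (κ x))
      have := hs.map F.vert
      simpa only [List.map_append, List.map_cons, List.map_nil, ha, hb, hf.kappa.vert,
        List.cons_append, List.nil_append] using this
    rw [← hvert p q hq, hind q hqc, hind _ hkc]
    rcases (hmem q).1 hqc with h₁ | h₁ <;> rcases (hmem _).1 hkc with h₂ | h₂
    · rw [if_pos h₁, if_pos h₂]; rfl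
    · exact (inter _ _ hq hkv h₁ h₂).elim
    · exact (inter _ _ hkv hq h₂ h₁).elim
    · rw [if_neg fun h => hdis _ h h₁, if_neg fun h => hdis _ h h₂, add_zero]
  · have hz : ∀ a, ¬ γ.Traverses a → F.edgeIndicator (x :: A) a = 0 := by
      intro a ha
      rw [edgeIndicator, if_neg]
      intro hm
      exact ha ⟨c, hc, hm.imp (fun h => (hmem _).2 (Or.inl h)) fun h => (hmem _).2 (Or.inl h)⟩
    rw [hz p ht, hz (κ p) fun h => ht (hC.traverses_of_vert_eq hγ (hf.kappa.vert p).symm h),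
      add_zero]

/-! ### Integrals of vertex functions and invariance as a linear system. -/

-- The integral is the superposition of the arcs from `exists_arc`, the one at `w` taken with
-- coefficient `g w`.
open Classical in
theorem exists_integral [Fintype V] (hf : IsEulerFrame C ρ κ out) (hC : F.IsEulerSystem C)
    (hs : Function.Surjective F.vert) (g : V → ZMod 2) :
    ∃ f : H → ZMod 2, (∀ h, f (F.mate h) = f h) ∧ (∀ h, f h + f (ρ h) = g (F.vert h)) ∧
      ∀ p, f p + f (κ p) = g (F.vert p) +
        ∑ w, (if (interlacementGraph C).Adj (F.vert p) w then 1 else 0) * g w := by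
  choose e he using hs
  choose a h₁ h₂ h₃ using fun w => hf.exists_arc hC (e w)
  simp only [he] at h₂ h₃
  refine ⟨fun h => ∑ w, g w * a w h, fun h => ?_, fun h => ?_, fun p => ?_⟩
  · simp only [h₁]
  · simp only [← Finset.sum_add_distrib, ← mul_add, h₂]
    simp
  · simp only [← Finset.sum_add_distrib, ← mul_add, h₃]
    simp [mul_add, Finset.sum_add_distrib]

open Classical in
theorem add_kappa_eq_sum [Fintype V] (hf : IsEulerFrame C ρ κ out) (hC : F.IsEulerSystem C)
    (hs : Function.Surjective F.vert) {f : H → ZMod 2} {g : V → ZMod 2}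
    (hm : ∀ h, f (F.mate h) = f h) (hfg : ∀ h, f h + f (ρ h) = g (F.vert h)) (p : H) :
    f p + f (κ p) = g (F.vert p) +
      ∑ w, (if (interlacementGraph C).Adj (F.vert p) w then 1 else 0) * g w := by
  obtain ⟨f', h₁, h₂, h₃⟩ := hf.exists_integral hC hs g
  rw [← h₃, hf.add_kappa_congr hC hm h₁ (fun h => (hfg h).trans (h₂ h).symm)]

-- With A the interlacement matrix, f(h) + f(ρ h) = g and f(h) + f(κ h) = g + A g. For χ, adding f(κ
-- h) + f(ρ (κ h)) = g to the latter leaves A g.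
open Classical in
theorem labelTransition_apply_eq_iff [Fintype V] (hf : IsEulerFrame C ρ κ out)
    (hC : F.IsEulerSystem C) (hs : Function.Surjective F.vert) {f : H → ZMod 2} {g : V → ZMod 2}
    (hm : ∀ h, f (F.mate h) = f h) (hfg : ∀ h, f h + f (ρ h) = g (F.vert h))
    (P : LabeledPartition V) (h : H) :
    f (F.labelTransition ρ κ P h) = f h ↔
      if P (F.vert h) = PartLabel.phi then g (F.vert h) = 0
      else (∑ w, (if (interlacementGraph C).Adj (F.vert h) w then 1 else 0) * g w) +
        (if P (F.vert h) = PartLabel.psi then g (F.vert h) else 0) = 0 := by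
  have h₁ := hfg h
  have h₂ := hfg (κ h)
  have h₃ := hf.add_kappa_eq_sum hC hs hm hfg h
  rw [hf.kappa.vert] at h₂
  generalize (∑ w, (if (interlacementGraph C).Adj (F.vert h) w then 1 else 0) * g w) = s at *
  rcases hP : P (F.vert h) with _ | _ | _
  · rw [labelTransition_phi hP, if_pos rfl]
    clear h₂ h₃
    generalize g (F.vert h) = r, f h = a, f (ρ h) = b at *
    revert a b r; decide
  · rw [labelTransition_chi hP, if_neg (by decide), if_neg (by decide)]
    generalize g (F.vert h) = r, f h = a, f (ρ h) = b, f (κ h) = c, f (ρ (κ h)) = d at *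
    clear h₁
    revert a c d r s; decide
  · rw [labelTransition_psi hP, if_neg (by decide), if_pos rfl]
    generalize g (F.vert h) = r, f h = a, f (ρ h) = b, f (κ h) = c, f (ρ (κ h)) = d at *
    clear h₁ h₂
    revert a c r s; decide

/-- This makes the derivative of an invariant function well defined at a vertex. Passing from `p` to
`κ p`, both sums vanish for φ, the two summands are exchanged for χ, and each is unchanged for ψ. -/
theorem add_rho_eq_of_vert_eq (hf : IsEulerFrame C ρ κ out) {P : LabeledPartition V}
    {f : H → ZMod 2} (hfi : f ∈ F.invariants (F.labelTransition ρ κ P)) {p q : H}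
    (hpq : F.vert q = F.vert p) : f q + f (ρ q) = f p + f (ρ p) := by
  have hk : f (κ p) + f (ρ (κ p)) = f p + f (ρ p) := by
    have h₁ := hfi.2 p
    have h₂ := hfi.2 (κ p)
    have h₃ := hfi.2 (ρ p)
    rcases hP : P (F.vert p) with _ | _ | _
    · rw [labelTransition_phi hP] at h₁
      rw [labelTransition_phi (by rw [hf.kappa.vert, hP])] at h₂
      rw [h₁, h₂, CharTwo.add_self_eq_zero, CharTwo.add_self_eq_zero]
    · rw [labelTransition_chi hP] at h₁
      rw [labelTransition_chi (by rw [hf.kappa.vert, hP]), hf.kappa.invol] at h₂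
      rw [h₁, ← h₂, add_comm]
    · rw [labelTransition_psi hP] at h₁
      rw [labelTransition_psi (by rw [hf.rho.vert, hP]), hf.comm] at h₃
      rw [h₁, h₃]
  rcases hf.cover q p hpq with rfl | rfl | rfl | rfl
  · rfl
  · rw [hf.rho.invol, add_comm]
  · exact hk
  · rw [hf.rho.invol, add_comm, hk]

end IsEulerFrame

end HalfEdgeGraph
-- The adjacency matrix of G_P and the circuit-nullity formula.
theorem LoopedGraph.finrank_ker_eq_nullity {W : Type*} [Fintype W] (G : LoopedGraph W) :
    Module.finrank (ZMod 2) (LinearMap.ker G.adjMatrix.mulVecLin) = G.nullity := by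
  have h := LinearMap.finrank_range_add_finrank_ker G.adjMatrix.mulVecLin
  rw [Module.finrank_fintype_fun_eq_card] at h
  rw [nullity, Matrix.rank, ← h, Nat.add_sub_cancel_left]

open Classical in
theorem LabeledSimpleGraph.adjMatrix_assocGraph_mulVec {V : Type*} [Fintype V]
    (G : SimpleGraph V) (P : LabeledPartition V) [Fintype {v : V // P v ≠ PartLabel.phi}]
    (g : V → ZMod 2) (hg : ∀ v, P v = PartLabel.phi → g v = 0)
    (w : {v : V // P v ≠ PartLabel.phi}) :
    (assocGraph G P).adjMatrix.mulVec (fun u => g u.1) w =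
      (∑ u, (if G.Adj w.1 u then 1 else 0) * g u) +
        if P w.1 = PartLabel.psi then g w.1 else 0 := by
  -- The entry splits as a sum because a simple graph has no loops, so the two alternatives for
  -- adjacency exclude each other.
  have hM : ∀ u, (assocGraph G P).adjMatrix w u =
      (if G.Adj w.1 u.1 then 1 else 0) + if w = u then (if P w.1 = PartLabel.psi then 1 else 0)
        else 0 := by
    intro u
    simp only [LoopedGraph.adjMatrix, assocGraph, Matrix.of_apply]
    by_cases e : w = u
    · subst e; simp
    · simp [e]
  have hsub : ∑ u, (if G.Adj w.1 u then 1 else 0) * g u =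
      ∑ u : {v : V // P v ≠ PartLabel.phi}, (if G.Adj w.1 u.1 then 1 else 0) * g u.1 := by
    rw [← Finset.sum_subtype (Finset.univ.filter fun v => P v ≠ PartLabel.phi) (by simp)
      fun u => (if G.Adj w.1 u then 1 else 0) * g u, Finset.sum_filter_of_ne]
    intro v _ hne hP
    exact hne (by rw [hg v hP, mul_zero])
  simp only [Matrix.mulVec, dotProduct, hM, add_mul, Finset.sum_add_distrib, hsub]
  simp

namespace HalfEdgeGraph

variable {V H : Type*} {F : HalfEdgeGraph V H}

namespace IsEulerFrame

variable {C : Finset F.Circuit} {ρ κ : H → H} {out : H → Prop}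

/-- Rank-nullity for the derivative `Φ` on the invariants: its kernel consists of the
`ρ`-invariants, its range is the kernel of the adjacency matrix of G_P. -/
theorem finrank_invariants_labelTransition [Fintype V] [Finite H] (hf : IsEulerFrame C ρ κ out)
    (hC : F.IsEulerSystem C) (hs : Function.Surjective F.vert) (P : LabeledPartition V)
    [Fintype {v : V // P v ≠ PartLabel.phi}] :
    Module.finrank (ZMod 2) (F.invariants (F.labelTransition ρ κ P)) =
      Module.finrank (ZMod 2) (F.invariants ρ) +
        (LabeledSimpleGraph.assocGraph (interlacementGraph C) P).nullity := by
  classical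
  have := Fintype.ofFinite H
  choose e he using hs
  let Φ : (H → ZMod 2) →ₗ[ZMod 2] ({v : V // P v ≠ PartLabel.phi} → ZMod 2) :=
    { toFun := fun f w => f (e w.1) + f (ρ (e w.1))
      map_add' := fun f f' => funext fun w => by
        simp only [Pi.add_apply]; ring
      map_smul' := fun r f => funext fun w => by
        simp only [Pi.smul_apply, smul_eq_mul, RingHom.id_apply]; ring }
  set S := F.invariants (F.labelTransition ρ κ P) with hS
  have hle : F.invariants ρ ≤ S := fun f h =>
    ⟨h.1, fun a => hf.apply_eq_of_mem_invariants hC h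
      ((hf.isTransition_labelTransition P).vert a)⟩
  have hdiff : ∀ f ∈ S, ∀ h, f h + f (ρ h) = f (e (F.vert h)) + f (ρ (e (F.vert h))) :=
    fun f h a => hf.add_rho_eq_of_vert_eq h (he _).symm
  have hker : LinearMap.ker (Φ.domRestrict S) = (F.invariants ρ).comap S.subtype := by
    ext ⟨f, h⟩
    rw [LinearMap.mem_ker, Submodule.mem_comap]
    constructor
    · intro hz
      refine ⟨h.1, fun a => ?_⟩
      -- `Φ` does not record the vertices labeled φ, but there the transition is `ρ` itself.
      by_cases hP : P (F.vert a) = PartLabel.phi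
      · have := h.2 a
        rwa [labelTransition_phi hP] at this
      · have h₁ : f (e (F.vert a)) + f (ρ (e (F.vert a))) = 0 := congrFun hz ⟨F.vert a, hP⟩
        rw [← hdiff f h, CharTwo.add_eq_zero] at h₁
        exact h₁.symm
    · intro hi
      funext w
      change f _ + f (ρ _) = 0
      rw [show f (ρ (e w.1)) = f (e w.1) from hi.2 _, CharTwo.add_self_eq_zero]
  have hrange : LinearMap.range (Φ.domRestrict S) = LinearMap.ker
      (LabeledSimpleGraph.assocGraph (interlacementGraph C) P).adjMatrix.mulVecLin := by
    ext u
    rw [LinearMap.mem_range, LinearMap.mem_ker, Matrix.mulVecLin_apply]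
    constructor
    · rintro ⟨⟨f, h⟩, rfl⟩
      set g : V → ZMod 2 := fun v => f (e v) + f (ρ (e v)) with hg
      have key := fun a => (hf.labelTransition_apply_eq_iff hC (fun v => ⟨e v, he v⟩) (g := g) h.1
        (hdiff f h) P a).1 (h.2 a)
      have hg0 : ∀ v, P v = PartLabel.phi → g v = 0 := by
        intro v hv
        have := key (e v)
        rwa [he, if_pos hv] at this
      funext w
      have h₁ := key (e w.1)
      rw [he, if_neg w.2, ← LabeledSimpleGraph.adjMatrix_assocGraph_mulVec _ P g hg0 w] at h₁
      exact h₁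
    · intro hu
      -- A kernel vector is extended by zero, the value forced at vertices labeled φ, and then
      -- integrated.
      set g : V → ZMod 2 := fun v => if hv : P v ≠ PartLabel.phi then u ⟨v, hv⟩ else 0 with hg
      have hg0 : ∀ v, P v = PartLabel.phi → g v = 0 := fun v hv => dif_neg (not_not.2 hv)
      have hgu : (fun w : {v : V // P v ≠ PartLabel.phi} => g w.1) = u :=
        funext fun w => dif_pos w.2
      obtain ⟨f, h₁, h₂, -⟩ := hf.exists_integral hC (fun v => ⟨e v, he v⟩) g
      have hfS : f ∈ S := by
        refine ⟨h₁, fun a => ?_⟩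
        rw [hf.labelTransition_apply_eq_iff hC (fun v => ⟨e v, he v⟩) h₁ h₂]
        split_ifs with hP hψ
        · exact hg0 _ hP
        all_goals
          have := LabeledSimpleGraph.adjMatrix_assocGraph_mulVec (interlacementGraph C) P g hg0
            ⟨F.vert a, hP⟩
          rw [hgu, hu] at this
          simpa [hψ] using this.symm
      refine ⟨⟨f, hfS⟩, ?_⟩
      rw [← hgu]
      funext w
      change f (e w.1) + f (ρ (e w.1)) = g w.1
      rw [h₂, he]
  rw [← LinearMap.finrank_range_add_finrank_ker (Φ.domRestrict S), hrange, hker,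
    LoopedGraph.finrank_ker_eq_nullity, (Submodule.comapSubtypeEquivOfLe hle).finrank_eq, add_comm]

/-- The circuit-nullity formula. -/
theorem card_eq_numComponents_add_nullity [Fintype V] [Finite H] (hf : IsEulerFrame C ρ κ out)
    (hC : F.IsEulerSystem C) (hs : Function.Surjective F.vert) (P : LabeledPartition V)
    [Fintype {v : V // P v ≠ PartLabel.phi}] {Q : Finset F.Circuit}
    (hQ : F.IsCircuitPartition Q) (hQP : HasTransition Q (F.labelTransition ρ κ P)) :
    Q.card = F.numComponents +
      (LabeledSimpleGraph.assocGraph (interlacementGraph C) P).nullity := by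
  rw [← hQP.finrank_invariants hQ, hf.finrank_invariants_labelTransition hC hs P,
    hf.hasTransition.finrank_invariants hC.isCircuitPartition, hC.card_eq_numComponents]

/-! ### Labeled partitions correspond to circuit partitions. -/

/-- The circuit partition whose transitions have prescribed names. -/
noncomputable def partitionOf [Finite H] (hf : IsEulerFrame C ρ κ out) (P : LabeledPartition V) :
    F.CircuitPartition :=
  ⟨F.circuitsOf (F.labelTransition ρ κ P), (hf.isTransition_labelTransition P).isCircuitPartition⟩

theorem hasTransition_partitionOf [Finite H] (hf : IsEulerFrame C ρ κ out)
    (P : LabeledPartition V) : HasTransition (hf.partitionOf P).1 (F.labelTransition ρ κ P) :=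
  (hf.isTransition_labelTransition P).hasTransition_circuitsOf

theorem phiSet_partitionOf [Fintype V] [Finite H] (hf : IsEulerFrame C ρ κ out)
    (hs : Function.Surjective F.vert) (P : LabeledPartition V) :
    phiSet (hf.partitionOf P).1 C = Finset.univ.filter fun v => P v = PartLabel.phi := by
  classical
  refine Finset.filter_congr fun v _ => ?_
  obtain ⟨h, rfl⟩ := hs v
  exact hf.followsAt_iff (hf.hasTransition_partitionOf P) h

theorem chiSet_partitionOf [Fintype V] [Finite H] (hf : IsEulerFrame C ρ κ out)
    (hs : Function.Surjective F.vert) (P : LabeledPartition V) :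
    chiSet (hf.partitionOf P).1 C = Finset.univ.filter fun v => P v = PartLabel.chi := by
  classical
  refine Finset.filter_congr fun v _ => ?_
  obtain ⟨h, rfl⟩ := hs v
  rw [hf.followsAt_iff (hf.hasTransition_partitionOf P) h,
    hf.consistentAt_iff (hf.hasTransition_partitionOf P) h]
  cases P (F.vert h) <;> decide

theorem psiSet_partitionOf [Fintype V] [Finite H] (hf : IsEulerFrame C ρ κ out)
    (hs : Function.Surjective F.vert) (P : LabeledPartition V) :
    psiSet (hf.partitionOf P).1 C = Finset.univ.filter fun v => P v = PartLabel.psi := by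
  classical
  refine Finset.filter_congr fun v _ => ?_
  obtain ⟨h, rfl⟩ := hs v
  rw [hf.consistentAt_iff (hf.hasTransition_partitionOf P) h, not_not]

/-- The labels can be read off from the sets φ and χ of the partition; conversely a partition is
determined by its transitions, which always have names. -/
theorem partitionOf_bijective [Fintype V] [Finite H] (hf : IsEulerFrame C ρ κ out)
    (hs : Function.Surjective F.vert) : Function.Bijective hf.partitionOf := by
  constructor
  · intro P P' hPP
    have hφ := hf.phiSet_partitionOf hs P
    have hχ := hf.chiSet_partitionOf hs P
    rw [hPP, hf.phiSet_partitionOf hs] at hφ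
    rw [hPP, hf.chiSet_partitionOf hs] at hχ
    funext v
    have h₁ := Finset.ext_iff.1 hφ v
    have h₂ := Finset.ext_iff.1 hχ v
    simp only [Finset.mem_filter_univ] at h₁ h₂
    revert h₁ h₂
    cases P v <;> cases P' v <;> simp
  · rintro ⟨Q, hQ⟩
    obtain ⟨τ, hτ, hQτ⟩ := hQ.exists_hasTransition
    obtain ⟨P, rfl⟩ := hf.exists_eq_labelTransition hτ
    exact ⟨P, Subtype.ext (hQτ.eq_circuitsOf hQ hτ).symm⟩

end IsEulerFrame

theorem IsRegular.vert_surjective {k : ℕ} (hF : F.IsRegular k) (hk : k ≠ 0) :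
    Function.Surjective F.vert := fun v =>
  Set.nonempty_of_ncard_ne_zero ((hF v).trans_ne hk)

end HalfEdgeGraph

theorem mainTheorem3 {V H : Type*} [Fintype V] [Fintype H] {R : Type*} [CommRing R]
    (F : HalfEdgeGraph V H) (hF : F.IsRegular 4) (C : LabeledEulerSystem F R) (y : R) :
    F.circuitPartitionGF C y = (F.labeledInterlacementGraph C).interlacePolynomial y := by
  classical
  obtain ⟨ρ, κ, out, hf⟩ := C.isEulerSystem.exists_frame hF
  have hs := hF.vert_surjective four_ne_zero
  refine (Fintype.sum_bijective hf.partitionOf (hf.partitionOf_bijective hs) _ _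
    fun P => ?_).symm
  rw [hf.phiSet_partitionOf hs, hf.chiSet_partitionOf hs, hf.psiSet_partitionOf hs,
    hf.card_eq_numComponents_add_nullity C.isEulerSystem hs P (hf.partitionOf P).2
      (hf.hasTransition_partitionOf P), Nat.add_sub_cancel_left]
  rfl
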